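/- Conventions. A Cantor space is a nonempty compact, metrizable, perfect, zero-dimensional topological space. A minimal Cantor system is a pair $(X,T)$ where $X$ is a Cantor space and $T:X\to X$ is a homeomorphism such that every orbit $\mathcal{O}_T(x)=\{T^n(x):n\in\mathbb{Z}\}$ is dense in $X$. Two maps $f:X\to X$ and $g:Y\to Y$ are conjugate if there is a homeomorphism $h:X\to Y$ with $h\circ f=g\circ h$. Minimal Cantor systems $(X,T)$ and $(Y,S)$ are orbit equivalent if $(Y,S)$ is conjugate to $(X,T')$ for some homeomorphism $T':X\to X$ having the same orbits as $T$, i.e. $\mathcal{O}_{T'}(x)=\mathcal{O}_T(x)$ for all $x\in X$. The system $(Y,S)$ is a speedup of $(X,T)$ if there is a function $p:X\to\mathbb{Z}^{+}$ (with no continuity assumption) such that $(Y,S)$ is conjugate to $(X,T')$, where $T'(x)=T^{p(x)}(x)$ for all $x\in X$. Two minimal Cantor systems are speedup equivalent if each is a speedup of the other. Corollary. Let $(X_1,T_1)$ and $(X_2,T_2)$ be minimal Cantor systems. If $(X_1,T_1)$ and $(X_2,T_2)$ are orbit equivalent, then they are speedup equivalent; that is, $(X_1,T_1)$ is a speedup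 of $(X_2,T_2)$ and $(X_2,T_2)$ is a speedup of $(X_1,T_1)$. -/

import Mathlib

namespace CantorDynamics

/-- A Cantor space: a nonempty, compact, metrizable, perfect, zero-dimensional topological space
(zero-dimensional: the clopen sets form a base of the topology). -/
class IsCantorSpace (X : Type*) [TopologicalSpace X] : Prop where
  nonempty : Nonempty X
  compact : CompactSpace X
  metrizable : TopologicalSpace.MetrizableSpace X
  perfect : PerfectSpace X
  clopen_basis : TopologicalSpace.IsTopologicalBasis {U : Set X | IsClopen U}

/-- The two-sided orbit `{T ^ n x : n ∈ ℤ}` of a point under a homeomorphism. -/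
def orbit {X : Type*} [TopologicalSpace X] (T : X ≃ₜ X) (x : X) : Set X :=
  {y | ∃ n : ℤ, (T ^ n) x = y}

/-- `(X, T)` is a minimal Cantor system: `X` is a Cantor space, `T` is a homeomorphism of `X`, and
every orbit of `T` is dense. -/
structure IsMinimalCantorSystem {X : Type*} [TopologicalSpace X] (T : X ≃ₜ X) : Prop where
  cantor : IsCantorSpace X
  dense_orbit : ∀ x : X, Dense (orbit T x)

/-- Topological conjugacy of two self-maps `f : X → X` and `g : Y → Y`: there is a homeomorphism
`h : X → Y` with `h ∘ f = g ∘ h`. -/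
def AreConjugate {X Y : Type*} [TopologicalSpace X] [TopologicalSpace Y]
    (f : X → X) (g : Y → Y) : Prop :=
  ∃ h : X ≃ₜ Y, Function.Semiconj h f g

/-- `(X, T)` and `(Y, S)` are orbit equivalent: `(Y, S)` is conjugate to some homeomorphism `T'` of
`X` which has the same orbits as `T`. -/
def AreOrbitEquivalent {X Y : Type*} [TopologicalSpace X] [TopologicalSpace Y]
    (T : X ≃ₜ X) (S : Y ≃ₜ Y) : Prop :=
  ∃ T' : X ≃ₜ X, (∀ x : X, orbit T' x = orbit T x) ∧ AreConjugate T' S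

/-- `IsSpeedup S T` says that `(Y, S)` is a speedup of `(X, T)`: there is a jump function
`p : X → ℤ⁺` (no regularity required) such that `(Y, S)` is conjugate to `(X, T')`, where
`T' x = T ^ (p x) x`. -/
def IsSpeedup {X Y : Type*} [TopologicalSpace X] [TopologicalSpace Y]
    (S : Y ≃ₜ Y) (T : X ≃ₜ X) : Prop :=
  ∃ p : X → ℕ, (∀ x : X, 0 < p x) ∧ AreConjugate (fun x => (T ^ p x) x) S

/-- Two systems are speedup equivalent when each of them is a speedup of the other. -/
def AreSpeedupEquivalent {X Y : Type*} [TopologicalSpace X] [TopologicalSpace Y]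
    (T : X ≃ₜ X) (S : Y ≃ₜ Y) : Prop :=
  IsSpeedup T S ∧ IsSpeedup S T

end CantorDynamics

/-!
Let `T` be minimal on a Cantor space `X`. Transporting by the conjugacy in the definition of orbit
equivalence, the theorem reduces to `isSpeedup_of_mem_fullGroup`: if `S` has dense orbits and maps
every point into its `T`-orbit (`S ∈ fullGroup T`), then some conjugate `h S h⁻¹` moves every point
strictly forward along its `T`-orbit.

The link between `S` and `T` is provided by the `T`-invariant probability measures. An element of
`fullGroup T` preserves them, because it is a power of `T` on each of countably many closed pieces
(`MeasureEq.of_mem_fullGroup`). Conversely, a clopen set `A` with `μ A < μ B` for all invariant `μ`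
can be moved forward into `B`: by compactness of the space of probability measures, the orbits visit
`A` less often than `B` on all segments of some fixed length (`MeasureLT.exists_visits_lt`), and
then the greedy matching, which joins points of `A` to later points of `B` in order of increasing
distance, exhausts `A` (`visits_le_of_mem_unmatched`). If `μ A = μ B` for all `μ`, a
back-and-forth that leaves over smaller and smaller neighbourhoods of two points `a ∈ A` and `b ∈ B`
yields a homeomorphism from `A` onto `B` that moves every point forward
(`MeasureEq.forwardEquiv`); only at `a` need the size of the jump be discontinuous.

The conjugating homeomorphism `h` is a limit of `g n`, where the conjugate `S n = g n * S * (g n)⁻¹`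
moves points forward outside a clopen neighbourhood `C n` of a fixed point `x₀`, agrees with `S m`
outside `C m` for `m ≤ n`, and maps `x₀` to a fixed point in its future. As `C n` shrinks to `x₀`,
the limit moves every point forward. For the step (`exists_conj_forward`), each
cell `E` of a fine partition of `C n \ C (n + 1)` has the same measures as `S n '' E`, so `S n * τ`
moves the points of `C n \ C (n + 1)` forward for some `τ` preserving the cells. Cutting orbits into
segments that end in `C (n + 1)`, one may change `S n` into `S n * τ` away from `C (n + 1)` by a
conjugation, the error being pushed along the segments into `C (n + 1)`. The conjugating map is
`x ↦ (S n * τ) ^ d x (S n ^ (-d x) x)`, where `d x` is the bounded height of `x` in its segment, so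
it is close to the identity when `τ` is, and the sequences `g n` and `(g n)⁻¹` converge uniformly.
-/

namespace CantorDynamics

open Set Filter Topology MeasureTheory
open scoped ENNReal

/-! ### Homeomorphisms preserving the cells of a clopen partition -/

section Stab

variable {X : Type*} [TopologicalSpace X]

/-- The group of homeomorphisms of `X` that preserve every cell of the clopen partition `Q`. On a
Cantor space these groups form a neighbourhood basis of the identity for the topology of uniform
convergence. -/
def cellStabilizer (Q : DiscreteQuotient X) : Subgroup (X ≃ₜ X) where
  carrier := {g | ∀ x, Q.proj (g x) = Q.proj x}
  mul_mem' {a b} ha hb x := (ha (b x)).trans (hb x)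
  one_mem' _ := rfl
  inv_mem' {a} ha x := by
    have := ha (a⁻¹ x)
    rw [← Homeomorph.mul_apply, mul_inv_cancel] at this
    exact this.symm

lemma proj_eq_of_le {P Q : DiscreteQuotient X} (h : P ≤ Q) {x y : X}
    (hxy : P.proj x = P.proj y) : Q.proj x = Q.proj y := by
  rw [← DiscreteQuotient.ofLE_proj h, hxy, DiscreteQuotient.ofLE_proj]

lemma cellStabilizer_mono {P Q : DiscreteQuotient X} (h : P ≤ Q) :
    cellStabilizer P ≤ cellStabilizer Q :=
  fun _ hg x => proj_eq_of_le h (hg x)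

/-- The pull-back of a clopen partition under a homeomorphism. -/
abbrev pullback (S : X ≃ₜ X) (Q : DiscreteQuotient X) : DiscreteQuotient X :=
  Q.comap ⟨S, S.continuous⟩

lemma pullback_proj_eq_iff {S : X ≃ₜ X} {Q : DiscreteQuotient X} {x y : X} :
    (pullback S Q).proj x = (pullback S Q).proj y ↔ Q.proj (S x) = Q.proj (S y) := by
  have h1 : (pullback S Q).proj x = (pullback S Q).proj y ↔ Q.toSetoid (S x) (S y) := Quotient.eq''
  have h2 : Q.proj (S x) = Q.proj (S y) ↔ Q.toSetoid (S x) (S y) := Quotient.eq''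
  rw [h1, h2]

lemma proj_ofIsClopen_eq_iff {A : Set X} (hA : IsClopen A) {x y : X} :
    (DiscreteQuotient.ofIsClopen hA).proj x = (DiscreteQuotient.ofIsClopen hA).proj y ↔
      (x ∈ A ↔ y ∈ A) :=
  Quotient.eq''

lemma conj_mem_cellStabilizer {S g : X ≃ₜ X} {Q : DiscreteQuotient X}
    (hg : g ∈ cellStabilizer (pullback S Q)) : S * g * S⁻¹ ∈ cellStabilizer Q := by
  intro x
  have := pullback_proj_eq_iff.1 (hg (S⁻¹ x))
  rw [← Homeomorph.mul_apply, ← Homeomorph.mul_apply, ← Homeomorph.mul_apply, mul_inv_cancel]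
    at this
  exact this

/-- A family of homeomorphisms, one on each cell of a clopen partition and each preserving the
cells, glues to a homeomorphism. -/
lemma exists_glue (Q : DiscreteQuotient X) (φ : X → X ≃ₜ X)
    (hφ : ∀ x y, Q.proj x = Q.proj y → φ x = φ y) (hQ : ∀ x, φ x ∈ cellStabilizer Q) :
    ∃ k ∈ cellStabilizer Q, ∀ x, k x = φ x x := by
  have key : ∀ ψ : X → X ≃ₜ X, (∀ x y, Q.proj x = Q.proj y → ψ x = ψ y) →
      Continuous fun x => ψ x x := by
    intro ψ hψ
    refine continuous_iff_continuousAt.2 fun x => ?_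
    refine (ψ x).continuous.continuousAt.congr ?_
    have hU : Q.proj ⁻¹' {Q.proj x} ∈ 𝓝 x := (Q.isOpen_preimage _).mem_nhds rfl
    filter_upwards [hU] with y hy
    rw [hψ y x hy]
  refine ⟨⟨⟨fun x => φ x x, fun x => (φ x)⁻¹ x, ?_, ?_⟩, key φ hφ, key (fun x => (φ x)⁻¹) ?_⟩,
    ?_, ?_⟩
  · intro x
    change (φ (φ x x))⁻¹ (φ x x) = x
    rw [hφ _ _ (hQ x x), ← Homeomorph.mul_apply, inv_mul_cancel, Homeomorph.one_apply]
  · intro x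
    change φ ((φ x)⁻¹ x) ((φ x)⁻¹ x) = x
    rw [hφ _ _ ((cellStabilizer Q).inv_mem (hQ x) x), ← Homeomorph.mul_apply, mul_inv_cancel,
      Homeomorph.one_apply]
  · intro x y h
    rw [hφ x y h]
  · exact fun x => hQ x x
  · exact fun x => rfl

/-- If `τ` preserves a sufficiently fine partition, then the powers of `S * τ` with bounded exponent
are close to the powers of `S`. -/
lemma exists_perturbation (S : X ≃ₜ X) (Q : DiscreteQuotient X) (N : ℕ) :
    ∃ R : DiscreteQuotient X, ∀ τ ∈ cellStabilizer R, ∀ d : ℤ, |d| ≤ N →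
      (S * τ) ^ d * S ^ (-d) ∈ cellStabilizer Q := by
  have key : ∀ d : ℤ, ∀ Q : DiscreteQuotient X, ∃ R : DiscreteQuotient X,
      ∀ τ ∈ cellStabilizer R, (S * τ) ^ d * S ^ (-d) ∈ cellStabilizer Q := by
    intro d
    induction d using Int.induction_on with
    | zero => exact fun Q => ⟨Q, fun τ _ => by simp [one_mem]⟩
    | succ i ih =>
      intro Q
      obtain ⟨R, hR⟩ := ih (pullback S Q)
      refine ⟨R ⊓ pullback S Q, fun τ hτ => ?_⟩
      have h := conj_mem_cellStabilizer (mul_mem (cellStabilizer_mono inf_le_right hτ)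
        (hR τ (cellStabilizer_mono inf_le_left hτ)))
      convert h using 1
      group
    | pred i ih =>
      intro Q
      obtain ⟨R, hR⟩ := ih (pullback S⁻¹ Q)
      refine ⟨R ⊓ Q, fun τ hτ => ?_⟩
      have h := mul_mem (inv_mem (cellStabilizer_mono inf_le_right hτ))
        (conj_mem_cellStabilizer (hR τ (cellStabilizer_mono inf_le_left hτ)))
      convert h using 1
      have : (S * τ) ^ (-(i : ℤ) - 1) = (S * τ)⁻¹ * (S * τ) ^ (-(i : ℤ)) := by
        rw [sub_eq_neg_add, zpow_add, zpow_neg_one]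
      rw [this]
      group
  choose R hR using fun d => key d Q
  refine ⟨(Finset.Icc (-(N : ℤ)) N).inf R, fun τ hτ d hd => hR d τ ?_⟩
  exact cellStabilizer_mono (Finset.inf_le (Finset.mem_Icc.2 (abs_le.1 hd))) hτ

lemma proj_step_le {D : ℕ → DiscreteQuotient X} (hD : Antitone D) {f : ℕ → X → X}
    (hstep : ∀ n x, (D n).proj (f (n + 1) x) = (D n).proj (f n x)) {m n : ℕ} (hmn : m ≤ n) (x : X) :
    (D m).proj (f n x) = (D m).proj (f m x) := by
  induction n, hmn using Nat.le_induction with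
  | base => rfl
  | succ n h ih => exact (proj_eq_of_le (hD h) (hstep n x)).trans ih

end Stab

/-! ### Cantor spaces and limits of homeomorphisms -/

section Cantor

variable {X : Type*} [TopologicalSpace X] [IsCantorSpace X]

instance IsCantorSpace.instNonempty : Nonempty X := IsCantorSpace.nonempty
instance IsCantorSpace.instCompactSpace : CompactSpace X := IsCantorSpace.compact
instance IsCantorSpace.instMetrizableSpace : TopologicalSpace.MetrizableSpace X :=
  IsCantorSpace.metrizable
instance IsCantorSpace.instPerfectSpace : PerfectSpace X := IsCantorSpace.perfect

lemma exists_isClopen_mem_subset {U : Set X} (hU : IsOpen U) {x : X} (hx : x ∈ U) :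
    ∃ V, IsClopen V ∧ x ∈ V ∧ V ⊆ U :=
  (IsCantorSpace.clopen_basis (X := X)).exists_subset_of_mem_open hx hU

instance IsCantorSpace.instTotallyDisconnectedSpace : TotallyDisconnectedSpace X := by
  have : TotallySeparatedSpace X := totallySeparatedSpace_iff_exists_isClopen.2 fun x y hxy => by
    obtain ⟨V, hV, hx, hVy⟩ :=
      exists_isClopen_mem_subset (isOpen_compl_singleton (x := y)) (x := x) hxy
    exact ⟨V, hV, hx, fun hy => hVy hy rfl⟩
  infer_instance

/-- A Cantor space has a decreasing sequence of clopen partitions that is cofinal among all clopen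
partitions. -/
lemma exists_cofinal_partitions (X : Type*) [TopologicalSpace X] [IsCantorSpace X] :
    ∃ D : ℕ → DiscreteQuotient X, Antitone D ∧ ∀ Q, ∃ n, D n ≤ Q := by
  let _ := TopologicalSpace.metrizableSpaceMetric X
  have h1 : SecondCountableTopology X := inferInstance
  have h2 : Countable (TopologicalSpace.Clopens X) :=
    TopologicalSpace.Clopens.countable_iff_secondCountable.2 h1
  have h3 : Countable (DiscreteQuotient X) :=
    (DiscreteQuotient.finsetClopens_inj X).countable
  obtain ⟨e, he⟩ := exists_surjective_nat (DiscreteQuotient X)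
  refine ⟨fun n => (Finset.range (n + 1)).inf e, fun m n hmn => ?_, fun Q => ?_⟩
  · exact Finset.inf_mono (Finset.range_mono (by omega))
  · obtain ⟨n, rfl⟩ := he Q
    exact ⟨n, Finset.inf_le (by simp)⟩

/-- A sequence of maps that is uniformly Cauchy with respect to a cofinal sequence of partitions
has a continuous limit. -/
lemma exists_limit_map {D : ℕ → DiscreteQuotient X} (hD : Antitone D) (hcof : ∀ Q, ∃ n, D n ≤ Q)
    {f : ℕ → X → X} (hf : ∀ n, Continuous (f n))
    (hstep : ∀ n x, (D n).proj (f (n + 1) x) = (D n).proj (f n x)) :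
    ∃ g : X → X, Continuous g ∧ ∀ n x, (D n).proj (g x) = (D n).proj (f n x) := by
  have hex : ∀ x, ∃ y, ∀ n, (D n).proj y = (D n).proj (f n x) := by
    intro x
    have := IsCompact.nonempty_iInter_of_sequence_nonempty_isCompact_isClosed
      (fun n => (D n).proj ⁻¹' {(D n).proj (f n x)}) ?_ (fun n => ⟨f n x, rfl⟩)
      ((D 0).isClosed_preimage _).isCompact (fun n => (D n).isClosed_preimage _)
    · obtain ⟨y, hy⟩ := this
      exact ⟨y, fun n => mem_iInter.1 hy n⟩
    · intro n y hy
      exact (proj_eq_of_le (hD n.le_succ) hy).trans (hstep n x)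
  choose g hg using hex
  refine ⟨g, ?_, fun n x => hg x n⟩
  refine IsCantorSpace.clopen_basis.continuous_iff.2 fun U hU => ?_
  obtain ⟨n, hn⟩ := hcof (DiscreteQuotient.ofIsClopen hU)
  have : g ⁻¹' U = f n ⁻¹' U := by
    ext x
    exact (proj_ofIsClopen_eq_iff hU).1 (proj_eq_of_le hn (hg x n))
  rw [this]
  exact hU.isOpen.preimage (hf n)

/-- A sequence of homeomorphisms that is uniformly Cauchy together with its inverses converges to a
homeomorphism. -/
lemma exists_limit_homeomorph {D : ℕ → DiscreteQuotient X} (hD : Antitone D)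
    (hcof : ∀ Q, ∃ n, D n ≤ Q) {g : ℕ → X ≃ₜ X}
    (hg : ∀ n x, (D n).proj (g (n + 1) x) = (D n).proj (g n x))
    (hg' : ∀ n x, (D n).proj ((g (n + 1))⁻¹ x) = (D n).proj ((g n)⁻¹ x)) :
    ∃ h : X ≃ₜ X, (∀ n x, (D n).proj (h x) = (D n).proj (g n x)) ∧
      ∀ n x, (D n).proj (h⁻¹ x) = (D n).proj ((g n)⁻¹ x) := by
  have inverse : ∀ {g : ℕ → X ≃ₜ X} {a b : X → X},
      (∀ n x, (D n).proj (g (n + 1) x) = (D n).proj (g n x)) →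
      (∀ n x, (D n).proj ((g (n + 1))⁻¹ x) = (D n).proj ((g n)⁻¹ x)) →
      (∀ n x, (D n).proj (a x) = (D n).proj (g n x)) →
      (∀ n x, (D n).proj (b x) = (D n).proj ((g n)⁻¹ x)) → ∀ x, b (a x) = x := by
    intro g a b hg hg' ha hb x
    refine DiscreteQuotient.eq_of_forall_proj_eq fun Q => ?_
    obtain ⟨l, hl⟩ := hcof Q
    obtain ⟨m, hm⟩ := hcof (pullback (g l)⁻¹ (D l))
    set n := max l m
    refine proj_eq_of_le hl ?_
    rw [hb l]
    have h1 : (D m).proj (a x) = (D m).proj (g n x) :=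
      (ha m x).trans (proj_step_le hD (f := fun n => g n) hg (le_max_right l m) x).symm
    have h2 := pullback_proj_eq_iff.1 (proj_eq_of_le hm h1)
    rw [h2, ← proj_step_le hD (f := fun n => ((g n)⁻¹ : X ≃ₜ X)) hg' (le_max_left l m),
      ← Homeomorph.mul_apply, inv_mul_cancel, Homeomorph.one_apply]
  obtain ⟨a, hac, ha⟩ := exists_limit_map hD hcof (fun n => (g n).continuous) hg
  obtain ⟨b, hbc, hb⟩ := exists_limit_map hD hcof (fun n => (g n)⁻¹.continuous) hg'
  refine ⟨⟨⟨a, b, inverse hg hg' ha hb, ?_⟩, hac, hbc⟩, ha, hb⟩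
  refine inverse (g := fun n => (g n)⁻¹) hg' ?_ hb ?_ <;> simpa only [inv_inv]

/-- If the conjugates `g n * S * (g n)⁻¹` eventually agree at a point, then so does the conjugate by
the limit of the `g n`. -/
lemma conj_limit_apply {D : ℕ → DiscreteQuotient X} (hD : Antitone D)
    (hcof : ∀ Q, ∃ n, D n ≤ Q) {g : ℕ → X ≃ₜ X} {h : X ≃ₜ X}
    (hg : ∀ n x, (D n).proj (g (n + 1) x) = (D n).proj (g n x))
    (hg' : ∀ n x, (D n).proj ((g (n + 1))⁻¹ x) = (D n).proj ((g n)⁻¹ x))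
    (hh : ∀ n x, (D n).proj (h x) = (D n).proj (g n x))
    (hh' : ∀ n x, (D n).proj (h⁻¹ x) = (D n).proj ((g n)⁻¹ x)) (S : X ≃ₜ X) {y z : X} {n : ℕ}
    (hyz : ∀ m, n ≤ m → (g m * S * (g m)⁻¹) y = z) : (h * S * h⁻¹) y = z := by
  refine DiscreteQuotient.eq_of_forall_proj_eq fun Q => ?_
  obtain ⟨l, hl⟩ := hcof Q
  obtain ⟨l', hl'⟩ := hcof (pullback (g l * S) (D l))
  set m := max (max l l') n
  refine proj_eq_of_le hl ?_
  have h1 : (D l').proj (h⁻¹ y) = (D l').proj ((g m)⁻¹ y) :=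
    (hh' l' y).trans (proj_step_le hD (f := fun n => ((g n)⁻¹ : X ≃ₜ X)) hg'
      ((le_max_right l l').trans (le_max_left _ n)) y).symm
  have h2 := pullback_proj_eq_iff.1 (proj_eq_of_le hl' h1)
  have h3 := proj_step_le hD (f := fun n => g n) hg
    ((le_max_left l l').trans (le_max_left _ n) : l ≤ m) (S ((g m)⁻¹ y))
  rw [← hyz m (le_max_right _ _)]
  exact (hh l _).trans (h2.trans h3.symm)

end Cantor

/-! ### Orbits, the full group and hitting times -/

section Orbits

variable {X : Type*} [TopologicalSpace X] {T S : X ≃ₜ X} {x y z : X}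

lemma orbit_refl (T : X ≃ₜ X) (x : X) : x ∈ orbit T x := ⟨0, by simp⟩

lemma orbit_trans (h₁ : y ∈ orbit T x) (h₂ : z ∈ orbit T y) : z ∈ orbit T x := by
  obtain ⟨m, rfl⟩ := h₁
  obtain ⟨n, rfl⟩ := h₂
  exact ⟨n + m, by rw [zpow_add, Homeomorph.mul_apply]⟩

lemma orbit_symm (h : y ∈ orbit T x) : x ∈ orbit T y := by
  obtain ⟨m, rfl⟩ := h
  exact ⟨-m, by rw [← Homeomorph.mul_apply, ← zpow_add, neg_add_cancel, zpow_zero,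
    Homeomorph.one_apply]⟩

/-- `y` lies strictly in the future of `x` along its `T`-orbit. -/
def InFuture (T : X ≃ₜ X) (x y : X) : Prop := ∃ n : ℕ, 0 < n ∧ (T ^ n) x = y

lemma InFuture.mem_orbit (h : InFuture T x y) : y ∈ orbit T x := by
  obtain ⟨n, -, h⟩ := h
  exact ⟨n, by rwa [zpow_natCast]⟩

lemma InFuture.inv (h : InFuture T x y) : InFuture T⁻¹ y x := by
  obtain ⟨n, hn, rfl⟩ := h
  exact ⟨n, hn, by rw [← Homeomorph.mul_apply, inv_pow, inv_mul_cancel, Homeomorph.one_apply]⟩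

/-- The full group of `T`: the homeomorphisms that map every point into its `T`-orbit. -/
def fullGroup (T : X ≃ₜ X) : Subgroup (X ≃ₜ X) where
  carrier := {g | ∀ x, g x ∈ orbit T x}
  mul_mem' {a b} ha hb x := orbit_trans (hb x) (ha (b x))
  one_mem' x := orbit_refl T x
  inv_mem' {a} ha x := by
    have := ha (a⁻¹ x)
    rw [← Homeomorph.mul_apply, mul_inv_cancel] at this
    exact orbit_symm this

/-- Every two-sided orbit is dense. -/
def HasDenseOrbits (T : X ≃ₜ X) : Prop := ∀ x, Dense (orbit T x)

lemma orbit_inv (T : X ≃ₜ X) (x : X) : orbit T⁻¹ x = orbit T x := by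
  ext y
  constructor
  · rintro ⟨n, rfl⟩
    exact ⟨-n, by rw [inv_zpow']⟩
  · rintro ⟨n, rfl⟩
    exact ⟨-n, by rw [inv_zpow', neg_neg]⟩

lemma HasDenseOrbits.inv (h : HasDenseOrbits T) : HasDenseOrbits T⁻¹ := fun x => by
  rw [orbit_inv]
  exact h x

lemma orbit_map_of_semiconj {Y : Type*} [TopologicalSpace Y] {a : X ≃ₜ X} {b : Y ≃ₜ Y} {h : X ≃ₜ Y}
    (hab : Function.Semiconj h a b) (x : X) : orbit b (h x) = h '' orbit a x := by
  have hpow : ∀ n : ℤ, ∀ x, (b ^ n) (h x) = h ((a ^ n) x) := by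
    intro n
    induction n using Int.induction_on with
    | zero => exact fun x => rfl
    | succ n ih =>
      intro x
      rw [zpow_add_one, zpow_add_one, Homeomorph.mul_apply, Homeomorph.mul_apply, ← hab x, ih]
    | pred n ih =>
      intro x
      have h1 : b⁻¹ (h x) = h (a⁻¹ x) := by
        refine b.injective ?_
        rw [← hab, ← Homeomorph.mul_apply, ← Homeomorph.mul_apply, mul_inv_cancel,
          mul_inv_cancel]
        rfl
      rw [zpow_sub_one, zpow_sub_one, Homeomorph.mul_apply, Homeomorph.mul_apply, h1, ih]
  ext y
  constructor
  · rintro ⟨n, rfl⟩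
    exact ⟨_, ⟨n, rfl⟩, (hpow n x).symm⟩
  · rintro ⟨_, ⟨n, rfl⟩, rfl⟩
    exact ⟨n, hpow n x⟩

lemma HasDenseOrbits.conj (h : HasDenseOrbits S) (g : X ≃ₜ X) :
    HasDenseOrbits (g * S * g⁻¹) := by
  intro x
  have hg : Function.Semiconj g S (g * S * g⁻¹ : X ≃ₜ X) := fun y => by
    rw [← Homeomorph.mul_apply (g * S * g⁻¹) g, inv_mul_cancel_right, Homeomorph.mul_apply]
  obtain ⟨y, rfl⟩ := g.surjective x
  rw [orbit_map_of_semiconj hg]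
  exact g.surjective.denseRange.dense_image g.continuous (h _)

end Orbits

section Minimal

variable {X : Type*} [TopologicalSpace X] [IsCantorSpace X] {T S : X ≃ₜ X}

lemma HasDenseOrbits.aperiodic (hT : HasDenseOrbits T) {x : X} {n : ℤ} (h : (T ^ n) x = x) :
    n = 0 := by
  by_contra hn
  have hper : ∀ q : ℤ, ((T ^ n) ^ q) x = x := by
    intro q
    have hfix : ∀ q : ℕ, ((T ^ n) ^ q) x = x := by
      intro q
      induction q with
      | zero => rfl
      | succ q ih => rw [pow_succ, Homeomorph.mul_apply, h, ih]
    obtain ⟨q, rfl | rfl⟩ := q.eq_nat_or_neg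
    · rw [zpow_natCast, hfix]
    · rw [zpow_neg, zpow_natCast]
      conv_lhs => rw [← hfix q]
      rw [← Homeomorph.mul_apply, inv_mul_cancel, Homeomorph.one_apply]
  have hfin : (orbit T x).Finite := by
    refine ((Set.finite_Icc (0 : ℤ) |n|).image fun m => (T ^ m) x).subset ?_
    rintro _ ⟨m, rfl⟩
    refine ⟨m % n, ⟨Int.emod_nonneg _ hn, (Int.emod_lt_abs _ hn).le⟩, ?_⟩
    conv_rhs => rw [← Int.emod_add_mul_ediv m n, zpow_add, zpow_mul, Homeomorph.mul_apply, hper]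
  have huniv : orbit T x = univ := by
    rw [← hfin.isClosed.closure_eq]
    exact (hT x).closure_eq
  exact infinite_of_mem_nhds x univ_mem (huniv ▸ hfin)

lemma HasDenseOrbits.zpow_injective (hT : HasDenseOrbits T) (x : X) :
    Function.Injective fun n : ℤ => (T ^ n) x := by
  intro m n h
  have : (T ^ (m - n)) x = x := by
    rw [sub_eq_neg_add, zpow_add, Homeomorph.mul_apply]
    change (T ^ (-n)) ((fun n : ℤ => (T ^ n) x) m) = x
    rw [h]
    change (T ^ (-n)) ((T ^ n) x) = x
    rw [← Homeomorph.mul_apply, ← zpow_add, neg_add_cancel, zpow_zero, Homeomorph.one_apply]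
  exact sub_eq_zero.1 (hT.aperiodic this)

/-- By compactness, the forward orbits visit a nonempty open set with bounded gaps. -/
lemma HasDenseOrbits.exists_bound_hitting (hT : HasDenseOrbits T) {U : Set X} (hU : IsOpen U)
    (hne : U.Nonempty) : ∃ N : ℕ, ∀ x, ∃ i < N, (T ^ i) x ∈ U := by
  obtain ⟨s, hs⟩ := isCompact_univ.elim_finite_subcover (fun n : ℤ => (T ^ n) ⁻¹' U)
    (fun n => hU.preimage (T ^ n).continuous) (fun x _ => by
      obtain ⟨_, hy, n, rfl⟩ := (hT x).inter_open_nonempty U hU hne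
      exact mem_iUnion.2 ⟨n, hy⟩)
  set K : ℕ := s.sup Int.natAbs
  refine ⟨2 * K + 1, fun x => ?_⟩
  obtain ⟨n, hn, hx⟩ := mem_iUnion₂.1 (hs (mem_univ ((T ^ K) x)))
  have hK : n.natAbs ≤ K := Finset.le_sup (f := Int.natAbs) hn
  refine ⟨(n + K).toNat, by omega, ?_⟩
  rw [← zpow_natCast, Int.toNat_of_nonneg (by omega), zpow_add, zpow_natCast]
  exact hx

lemma HasDenseOrbits.exists_inFuture (hT : HasDenseOrbits T) {U : Set X} (hU : IsOpen U)
    (hne : U.Nonempty) (x : X) : ∃ y ∈ U, InFuture T x y := by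
  obtain ⟨N, hN⟩ := hT.exists_bound_hitting hU hne
  obtain ⟨i, -, hi⟩ := hN (T x)
  exact ⟨_, hi, i + 1, by omega, by rw [pow_succ]; rfl⟩

/-- The first hitting time of a clopen set is locally constant. -/
lemma HasDenseOrbits.exists_hittingTime (hT : HasDenseOrbits T) {U : Set X} (hU : IsClopen U)
    (hne : U.Nonempty) : ∃ i : X → ℕ, IsLocallyConstant i ∧
      ∀ x n, i x = n ↔ (T ^ n) x ∈ U ∧ ∀ j < n, (T ^ j) x ∉ U := by
  classical
  obtain ⟨N, hN⟩ := hT.exists_bound_hitting hU.isOpen hne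
  have hex : ∀ x, ∃ n : ℕ, (T ^ n) x ∈ U := fun x => let ⟨i, _, h⟩ := hN x; ⟨i, h⟩
  have hspec : ∀ x n, Nat.find (hex x) = n ↔ (T ^ n) x ∈ U ∧ ∀ j < n, (T ^ j) x ∉ U :=
    fun x n => Nat.find_eq_iff _
  refine ⟨fun x => Nat.find (hex x), ?_, hspec⟩
  refine (IsLocallyConstant.iff_isOpen_fiber).2 fun n => ?_
  have : (fun x => Nat.find (hex x)) ⁻¹' {n} =
      (T ^ n) ⁻¹' U ∩ ⋂ j ∈ Finset.range n, ((T ^ j) ⁻¹' U)ᶜ := by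
    ext x
    simp only [mem_preimage, mem_singleton_iff, mem_inter_iff, mem_iInter, Finset.mem_range,
      mem_compl_iff]
    exact hspec x n
  rw [this]
  exact (hU.isOpen.preimage (T ^ n).continuous).inter (isOpen_biInter_finset fun j _ =>
    (hU.isClosed.preimage (T ^ j).continuous).isOpen_compl)

/-- A locally constant height function over a clopen set `C`: it increases by one along `S` outside
`C`. Cut the orbits into segments that start in `S '' C` and end in `C`. The height is counted from
the end of the segment if its first point is close to the first point of the segment ending in `x₀`,
and from the first point otherwise. Since `S x₀` starts a different segment, the height vanishes
both at `x₀` and at `S x₀`. -/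
lemma HasDenseOrbits.exists_height (hS : HasDenseOrbits S) {C : Set X} (hC : IsClopen C) {x₀ : X}
    (hx₀ : x₀ ∈ C) : ∃ d : X → ℤ, IsLocallyConstant d ∧ d x₀ = 0 ∧ d (S x₀) = 0 ∧
      ∀ x, x ∉ C → d (S x) = d x + 1 := by
  classical
  have hB : IsClopen ((S⁻¹ : X ≃ₜ X) ⁻¹' C) := hC.preimage S⁻¹.continuous
  have hSB : ∀ x, S x ∈ (S⁻¹ : X ≃ₜ X) ⁻¹' C ↔ x ∈ C := fun x => by
    rw [mem_preimage, ← Homeomorph.mul_apply, inv_mul_cancel, Homeomorph.one_apply]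
  obtain ⟨i, hi, hi'⟩ := hS.exists_hittingTime hC ⟨x₀, hx₀⟩
  obtain ⟨j, hj, hj'⟩ := hS.inv.exists_hittingTime hB ⟨S x₀, (hSB _).2 hx₀⟩
  have hiS : ∀ x, x ∉ C → i x = i (S x) + 1 := by
    intro x hx
    obtain ⟨h1, h2⟩ := (hi' (S x) _).1 rfl
    refine (hi' x _).2 ⟨by rwa [pow_succ], fun k hk => ?_⟩
    cases k with
    | zero => exact hx
    | succ k => rw [pow_succ]; exact h2 k (by omega)
  have hjS : ∀ x, x ∉ C → j (S x) = j x + 1 := by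
    intro x hx
    have hback : ∀ k : ℕ, ((S⁻¹) ^ (k + 1)) (S x) = ((S⁻¹) ^ k) x := fun k => by
      rw [pow_succ, Homeomorph.mul_apply, ← Homeomorph.mul_apply S⁻¹ S, inv_mul_cancel,
        Homeomorph.one_apply]
    obtain ⟨h1, h2⟩ := (hj' x _).1 rfl
    refine (hj' (S x) _).2 ⟨by rwa [hback], fun k hk => ?_⟩
    cases k with
    | zero => exact fun h => hx ((hSB x).1 h)
    | succ k => rw [hback]; exact h2 k (by omega)
  -- the first point of the orbit segment through `x`
  set b : X → X := fun x => ((S⁻¹) ^ j x) x with hb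
  have hbS : ∀ x, x ∉ C → b (S x) = b x := by
    intro x hx
    change ((S⁻¹) ^ j (S x)) (S x) = _
    rw [hjS x hx, pow_succ, Homeomorph.mul_apply, ← Homeomorph.mul_apply S⁻¹ S, inv_mul_cancel,
      Homeomorph.one_apply]
  have hbcont : Continuous b := by
    refine continuous_iff_continuousAt.2 fun x => ?_
    refine ((S⁻¹) ^ j x).continuous.continuousAt.congr ?_
    filter_upwards [(hj.isOpen_fiber (j x)).mem_nhds rfl] with y hy
    simp only [hb]
    rw [show j y = j x from hy]
  have hne : S x₀ ≠ b x₀ := by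
    intro h
    have h1 : (S ^ (1 : ℤ)) x₀ = (S ^ (-(j x₀ : ℤ))) x₀ := by
      rw [zpow_one, zpow_neg, zpow_natCast, ← inv_pow]
      exact h
    have := hS.zpow_injective x₀ h1
    omega
  have hjS0 : j (S x₀) = 0 := (hj' _ _).2 ⟨(hSB x₀).2 hx₀, fun k hk => absurd hk k.not_lt_zero⟩
  have hbS0 : b (S x₀) = S x₀ := by simp only [hb]; rw [hjS0]; rfl
  have hi0 : i x₀ = 0 := (hi' _ _).2 ⟨hx₀, fun k hk => absurd hk k.not_lt_zero⟩
  obtain ⟨W, hW, hbW, hSW⟩ := exists_isClopen_mem_subset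
    (isOpen_compl_singleton (x := S x₀)) (x := b x₀) (fun h => hne h.symm)
  refine ⟨fun x => if b x ∈ W then -(i x : ℤ) else j x, ?_, ?_, ?_, ?_⟩
  · refine (IsLocallyConstant.iff_eventually_eq _).2 fun x => ?_
    have h1 := (hi.isOpen_fiber (i x)).mem_nhds (x := x) rfl
    have h2 := (hj.isOpen_fiber (j x)).mem_nhds (x := x) rfl
    by_cases hx : b x ∈ W
    · filter_upwards [h1, (hW.isOpen.preimage hbcont).mem_nhds hx] with y hy hyW
      rw [if_pos (show b y ∈ W from hyW), if_pos hx, show i y = i x from hy]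
    · filter_upwards [h2, (hW.compl.isOpen.preimage hbcont).mem_nhds hx] with y hy hyW
      rw [if_neg (show b y ∉ W from hyW), if_neg hx, show j y = j x from hy]
  · simp only [if_pos hbW, hi0]; rfl
  · have : b (S x₀) ∉ W := fun h => hSW (hbS0 ▸ h) rfl
    simp only [if_neg this, hjS0]; rfl
  · intro x hx
    simp only [hbS x hx]
    split_ifs
    · have := hiS x hx
      omega
    · have := hjS x hx
      omega

end Minimal

/-! ### Invariant measures -/

section Measure

variable {X : Type*} [TopologicalSpace X] [MeasurableSpace X] {T : X ≃ₜ X} {A B : Set X}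

/-- `μ` is a `T`-invariant probability measure. -/
structure IsInvariantProb (T : X ≃ₜ X) (μ : Measure X) : Prop where
  prob : IsProbabilityMeasure μ
  preserving : MeasurePreserving T μ μ

/-- `A` and `B` have the same measure for every `T`-invariant probability measure. -/
def MeasureEq (T : X ≃ₜ X) (A B : Set X) : Prop := ∀ μ : Measure X, IsInvariantProb T μ → μ A = μ B

/-- `A` is smaller than `B` for every `T`-invariant probability measure. -/
def MeasureLT (T : X ≃ₜ X) (A B : Set X) : Prop := ∀ μ : Measure X, IsInvariantProb T μ → μ A < μ B

variable [BorelSpace X] {μ : Measure X}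

lemma IsInvariantProb.inv (h : IsInvariantProb T μ) : IsInvariantProb T⁻¹ μ :=
  ⟨h.prob, MeasurePreserving.symm T.toMeasurableEquiv h.preserving⟩

lemma isInvariantProb_inv_iff : IsInvariantProb T⁻¹ μ ↔ IsInvariantProb T μ :=
  ⟨fun h => by simpa using h.inv, fun h => h.inv⟩

lemma IsInvariantProb.zpow (h : IsInvariantProb T μ) (n : ℤ) :
    MeasurePreserving ((T ^ n : X ≃ₜ X)) μ μ := by
  have hpow : ∀ {T : X ≃ₜ X}, IsInvariantProb T μ → ∀ n : ℕ,
      MeasurePreserving ((T ^ n : X ≃ₜ X)) μ μ := by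
    intro T h n
    induction n with
    | zero => exact MeasurePreserving.id μ
    | succ n ih => rw [pow_succ]; exact ih.comp h.preserving
  obtain ⟨k, rfl | rfl⟩ := n.eq_nat_or_neg
  · rw [zpow_natCast]
    exact hpow h k
  · rw [← inv_zpow', zpow_natCast]
    exact hpow h.inv k

lemma IsInvariantProb.measure_image_zpow (h : IsInvariantProb T μ) (n : ℤ) (A : Set X) :
    μ ((T ^ n) '' A) = μ A := by
  have h1 : (T ^ n) '' A = (T ^ (-n)) ⁻¹' A := by
    rw [zpow_neg]
    exact (T ^ n).image_eq_preimage_symm A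
  rw [h1]
  exact (h.zpow (-n)).measure_preimage_emb (T ^ (-n)).measurableEmbedding A

/-- A continuous map defined on a clopen set that moves points along `T`-orbits does not increase
invariant measures: the set is a countable union of closed pieces on which the map is a power
of `T`. -/
lemma IsInvariantProb.measure_image_le [T2Space X] (h : IsInvariantProb T μ) (hA : IsClopen A)
    {f : X → X} (hf : ContinuousOn f A) (horb : ∀ x ∈ A, f x ∈ orbit T x) : μ (f '' A) ≤ μ A := by
  obtain ⟨e⟩ : Nonempty (ℕ ≃ ℤ) := ⟨(Denumerable.eqv ℤ).symm⟩
  set M : ℕ → Set X := fun n => {x ∈ A | f x = (T ^ e n) x} with hM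
  have hMm : ∀ n, MeasurableSet (M n) := by
    intro n
    have : IsClosed (M n) := by
      have hg : ContinuousOn (fun x => (f x, (T ^ e n) x)) A :=
        hf.prodMk (T ^ e n).continuous.continuousOn
      exact hg.preimage_isClosed_of_isClosed hA.isClosed isClosed_diagonal
    exact this.measurableSet
  have hAM : A = ⋃ n, disjointed M n := by
    rw [iUnion_disjointed]
    ext x
    constructor
    · intro hx
      obtain ⟨n, hn⟩ := horb x hx
      exact mem_iUnion.2 ⟨e.symm n, hx, by rw [e.apply_symm_apply, hn]⟩
    · intro hx
      obtain ⟨n, hn⟩ := mem_iUnion.1 hx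
      exact hn.1
  have himg : ∀ n, f '' disjointed M n = (T ^ e n) '' disjointed M n := fun n =>
    image_congr fun x hx => (disjointed_le M n hx).2
  calc μ (f '' A) = μ (⋃ n, (T ^ e n) '' disjointed M n) := by
        conv_lhs => rw [hAM, image_iUnion]
        simp only [himg]
    _ ≤ ∑' n, μ ((T ^ e n) '' disjointed M n) := measure_iUnion_le _
    _ = ∑' n, μ (disjointed M n) := by simp only [h.measure_image_zpow]
    _ = μ (⋃ n, disjointed M n) :=
        (measure_iUnion (disjoint_disjointed M) (fun n => MeasurableSet.disjointed hMm n)).symm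
    _ = μ A := by rw [← hAM]

/-- Elements of the full group preserve invariant measures. -/
lemma MeasureEq.of_mem_fullGroup [T2Space X] {S : X ≃ₜ X} (hS : S ∈ fullGroup T)
    (hA : IsClopen A) : MeasureEq T A (S '' A) := by
  intro μ hμ
  refine le_antisymm ?_ (hμ.measure_image_le hA S.continuous.continuousOn fun x _ => hS x)
  have hSA : IsClopen (S '' A) := ⟨S.isClosedMap _ hA.1, S.isOpenMap _ hA.2⟩
  have := hμ.measure_image_le hSA S⁻¹.continuous.continuousOn
    fun x _ => (fullGroup T).inv_mem hS x
  rwa [← image_comp, show (S⁻¹ : X ≃ₜ X) ∘ S = id from funext S.symm_apply_apply, image_id] at this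

lemma MeasureEq.diff (h : MeasureEq T A B) {C D : Set X} (h' : MeasureEq T C D) (hC : IsClopen C)
    (hD : IsClopen D) (hCA : C ⊆ A) (hDB : D ⊆ B) : MeasureEq T (A \ C) (B \ D) := by
  intro μ hμ
  have := hμ.prob
  rw [measure_sdiff hCA hC.isOpen.measurableSet.nullMeasurableSet (measure_ne_top μ C),
    measure_sdiff hDB hD.isOpen.measurableSet.nullMeasurableSet (measure_ne_top μ D), h μ hμ,
    h' μ hμ]

end Measure

section CantorMeasure

variable {X : Type*} [TopologicalSpace X] [IsCantorSpace X] [MeasurableSpace X] [BorelSpace X]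
  {T : X ≃ₜ X} {A B : Set X} {μ : Measure X}

lemma HasDenseOrbits.exists_measure_ge (hT : HasDenseOrbits T) {U : Set X} (hU : IsOpen U)
    (hne : U.Nonempty) :
    ∃ N : ℕ, ∀ μ : Measure X, IsInvariantProb T μ → 1 ≤ N * μ U := by
  obtain ⟨N, hN⟩ := hT.exists_bound_hitting hU hne
  refine ⟨N, fun μ hμ => ?_⟩
  have := hμ.prob
  calc (1 : ℝ≥0∞) = μ univ := measure_univ.symm
    _ ≤ μ (⋃ i ∈ Finset.range N, (T ^ (i : ℤ)) ⁻¹' U) := by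
        refine measure_mono fun x _ => ?_
        obtain ⟨i, hi, hx⟩ := hN x
        refine mem_biUnion (Finset.mem_coe.2 (Finset.mem_range.2 hi)) ?_
        rw [mem_preimage, zpow_natCast]
        exact hx
    _ ≤ ∑ i ∈ Finset.range N, μ ((T ^ (i : ℤ)) ⁻¹' U) := measure_biUnion_finset_le _ _
    _ = ∑ i ∈ Finset.range N, μ U := by
        refine Finset.sum_congr rfl fun i _ => ?_
        exact (hμ.zpow i).measure_preimage_emb (T ^ (i : ℤ)).measurableEmbedding U
    _ = N * μ U := by simp

/-- Every point has arbitrarily small clopen neighbourhoods whose measure is uniformly small,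
because many of their translates are disjoint. -/
lemma HasDenseOrbits.exists_small_nhd (hT : HasDenseOrbits T) {U V : Set X} (hU : IsOpen U)
    (hne : U.Nonempty) (hV : IsOpen V) {b : X} (hb : b ∈ V) :
    ∃ W, IsClopen W ∧ b ∈ W ∧ W ⊆ V ∧ MeasureLT T W U := by
  obtain ⟨N, hN⟩ := hT.exists_measure_ge hU hne
  set s : Finset ℕ := Finset.range (N + 1)
  obtain ⟨O, hO, hdisj⟩ := ((finite_Iio (N + 1)).image fun i : ℕ => (T ^ i) b).t2_separation
  have hinj : ∀ i j : ℕ, (T ^ i) b = (T ^ j) b → i = j := by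
    intro i j h
    have := hT.zpow_injective b (a₁ := i) (a₂ := j) (by simpa only [zpow_natCast] using h)
    exact_mod_cast this
  obtain ⟨W, hW, hbW, hWs⟩ := exists_isClopen_mem_subset
    (hV.inter (isOpen_biInter_finset (s := s) fun i _ =>
      (hO ((T ^ i) b)).2.preimage (T ^ i).continuous))
    ⟨hb, mem_iInter₂.2 fun i _ => (hO ((T ^ i) b)).1⟩
  refine ⟨W, hW, hbW, fun x hx => (hWs hx).1, fun μ hμ => ?_⟩
  have := hμ.prob
  have hWi : ∀ i ∈ s, ((T ^ (i : ℤ)) '' W) ⊆ O ((T ^ i) b) := by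
    rintro i hi _ ⟨x, hx, rfl⟩
    rw [zpow_natCast]
    exact mem_iInter₂.1 (hWs hx).2 i hi
  have hpd : (s : Set ℕ).PairwiseDisjoint fun i : ℕ => (T ^ (i : ℤ)) '' W := by
    intro i hi j hj hij
    refine (hdisj ⟨i, ?_, rfl⟩ ⟨j, ?_, rfl⟩ fun h => hij (hinj i j h)).mono (hWi i hi) (hWi j hj)
    · exact Finset.mem_range.1 hi
    · exact Finset.mem_range.1 hj
  have hsum : (N + 1) * μ W ≤ 1 := by
    calc ((N : ℝ≥0∞) + 1) * μ W = ∑ i ∈ s, μ ((T ^ (i : ℤ)) '' W) := by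
          simp only [hμ.measure_image_zpow, Finset.sum_const, s, Finset.card_range, nsmul_eq_mul]
          push_cast
          rfl
      _ = μ (⋃ i ∈ s, (T ^ (i : ℤ)) '' W) := by
          refine (measure_biUnion_finset hpd fun i _ => ?_).symm
          exact ((T ^ (i : ℤ)).isClosedMap _ hW.1).measurableSet
      _ ≤ 1 := prob_le_one
  by_contra hle
  rw [not_lt] at hle
  have h0 : μ W ≠ 0 := by
    intro h0
    have h := hN μ hμ
    rw [le_antisymm (hle.trans h0.le) zero_le, mul_zero] at h
    simp at h
  have h1 : (N + 1 : ℝ≥0∞) * μ W ≤ N * μ W :=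
    hsum.trans ((hN μ hμ).trans (mul_le_mul_right hle _))
  rw [add_mul, one_mul] at h1
  have hfin : (N : ℝ≥0∞) * μ W ≠ ∞ :=
    ENNReal.mul_ne_top (ENNReal.natCast_ne_top N) (measure_ne_top μ W)
  have h2 : μ W ≤ 0 := by
    refine (ENNReal.add_le_add_iff_left hfin).1 ?_
    rwa [add_zero]
  exact h0 (le_antisymm h2 zero_le)

end CantorMeasure

/-! ### Comparison of visit counts -/

section Visits

variable {X : Type*} [TopologicalSpace X] {T : X ≃ₜ X} {A B : Set X}

open Classical in
/-- The number of visits to `A` of the orbit segment `x, T x, …, T ^ (N - 1) x`. -/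
noncomputable def visits (T : X ≃ₜ X) (A : Set X) (N : ℕ) (x : X) : ℕ :=
  ∑ i ∈ Finset.range N, if (T ^ i) x ∈ A then 1 else 0

lemma visits_preimage_le (T : X ≃ₜ X) (A : Set X) (N : ℕ) (x : X) :
    visits T (T ⁻¹' A) N x ≤ visits T A N x + 1 := by
  classical
  have h1 : visits T (T ⁻¹' A) N x =
      ∑ i ∈ Finset.range N, if (T ^ (i + 1)) x ∈ A then 1 else 0 := by
    refine Finset.sum_congr rfl fun i _ => ?_
    rw [pow_succ']
    rfl
  have h2 := Finset.sum_range_succ' (fun i => if (T ^ i) x ∈ A then 1 else 0) N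
  have h3 := Finset.sum_range_succ (fun i => if (T ^ i) x ∈ A then 1 else 0) N
  have h4 : (if (T ^ N) x ∈ A then 1 else 0) ≤ 1 := by split_ifs <;> simp
  rw [h1]
  unfold visits
  omega

variable [MeasurableSpace X]

/-- The empirical measure of the orbit segment `x, T x, …, T ^ N x`. -/
noncomputable def empirical (T : X ≃ₜ X) (N : ℕ) (x : X) : Measure X :=
  ((N : ℝ≥0∞) + 1)⁻¹ • ∑ i ∈ Finset.range (N + 1), Measure.dirac ((T ^ i) x)

lemma empirical_apply (N : ℕ) (x : X) (hA : MeasurableSet A) :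
    empirical T N x A = ((N : ℝ≥0∞) + 1)⁻¹ * visits T A (N + 1) x := by
  classical
  simp only [empirical, Measure.smul_apply, Measure.finsetSum_apply, smul_eq_mul, visits]
  congr 1
  push_cast
  refine Finset.sum_congr rfl fun i _ => ?_
  rw [Measure.dirac_apply' _ hA, indicator_apply]
  simp

instance isProbabilityMeasure_empirical (N : ℕ) (x : X) :
    IsProbabilityMeasure (empirical T N x) := by
  constructor
  rw [empirical_apply N x MeasurableSet.univ]
  simp only [visits, mem_univ, if_true, Finset.sum_const, Finset.card_range, smul_eq_mul, mul_one]
  push_cast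
  exact ENNReal.inv_mul_cancel (by simp) (by simp)

end Visits

section Cantor

variable {X : Type*} [TopologicalSpace X] [IsCantorSpace X] [MeasurableSpace X] [BorelSpace X]
  {T : X ≃ₜ X} {A B : Set X}

/-- A uniform strict inequality between invariant measures is visible on all orbit segments of a
suitable length; otherwise a limit of empirical measures would be an invariant measure violating
it. -/
lemma MeasureLT.exists_visits_lt (hA : IsClopen A) (hB : IsClopen B) (h : MeasureLT T A B) :
    ∃ N, ∀ x, visits T A N x < visits T B N x := by
  by_contra! hcon
  choose x hx using fun N => hcon (N + 1)
  let P : ℕ → ProbabilityMeasure X := fun N => ⟨empirical T N (x N), inferInstance⟩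
  obtain ⟨μ, -, hμ⟩ := isCompact_univ.ultrafilter_le_nhds' ((hyperfilter ℕ).map P) univ_mem
  have htend : Tendsto P (hyperfilter ℕ) (𝓝 μ) := hμ
  have hlim : ∀ {U : Set X}, IsClopen U →
      Tendsto (fun N => empirical T N (x N) U) (hyperfilter ℕ) (𝓝 ((μ : Measure X) U)) :=
    fun hU => ProbabilityMeasure.tendsto_measure_of_null_frontier_of_tendsto' htend
      (by rw [hU.frontier_eq]; exact measure_empty)
  have hinv : Tendsto (fun N : ℕ => ((N : ℝ≥0∞) + 1)⁻¹) (hyperfilter ℕ) (𝓝 0) := by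
    have h1 := (tendsto_add_atTop_iff_nat 1).2 ENNReal.tendsto_inv_nat_nhds_zero
    refine (h1.congr fun N => ?_).mono_left Nat.hyperfilter_le_atTop
    push_cast
    rfl
  have hle : ∀ {U : Set X}, IsClopen U → (μ : Measure X) (T ⁻¹' U) ≤ (μ : Measure X) U := by
    intro U hU
    have hTU : IsClopen (T ⁻¹' U) := hU.preimage T.continuous
    have h2 := (hlim hU).add hinv
    rw [add_zero] at h2
    refine le_of_tendsto_of_tendsto' (hlim hTU) h2 fun N => ?_
    rw [empirical_apply N _ hTU.isOpen.measurableSet, empirical_apply N _ hU.isOpen.measurableSet]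
    calc _ ≤ ((N : ℝ≥0∞) + 1)⁻¹ * ((visits T U (N + 1) (x N) + 1 : ℕ) : ℝ≥0∞) := by
          gcongr
          exact visits_preimage_le T U (N + 1) (x N)
      _ = _ := by push_cast; rw [mul_add, mul_one]
  have heq : ∀ {U : Set X}, IsClopen U → (μ : Measure X) (T ⁻¹' U) = (μ : Measure X) U := by
    intro U hU
    have hTU : IsClopen (T ⁻¹' U) := hU.preimage T.continuous
    -- the reverse inequality is the first one for the complement
    refine le_antisymm (hle hU) ?_
    have h2 := hle hU.compl
    rw [preimage_compl, prob_compl_eq_one_sub hTU.isOpen.measurableSet,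
      prob_compl_eq_one_sub hU.isOpen.measurableSet] at h2
    exact (ENNReal.sub_le_sub_iff_left prob_le_one (by simp)).1 h2
  have hTμ : MeasurePreserving T (μ : Measure X) μ := by
    refine ⟨T.continuous.measurable, ?_⟩
    have : IsProbabilityMeasure (Measure.map T (μ : Measure X)) :=
      Measure.isProbabilityMeasure_map T.continuous.measurable.aemeasurable
    let _ := TopologicalSpace.metrizableSpaceMetric X
    refine ext_of_generate_finite {U : Set X | IsClopen U} ?_ ?_ ?_ (by simp)
    · rw [BorelSpace.measurable_eq (α := X)]
      exact IsCantorSpace.clopen_basis.borel_eq_generateFrom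
    · exact fun U hU V hV _ => hU.inter hV
    · intro U hU
      rw [Measure.map_apply T.continuous.measurable (IsClopen.isOpen hU).measurableSet]
      exact heq hU
  refine (h μ ⟨inferInstance, hTμ⟩).not_ge ?_
  refine le_of_tendsto_of_tendsto' (hlim hB) (hlim hA) fun N => ?_
  rw [empirical_apply N _ hB.isOpen.measurableSet, empirical_apply N _ hA.isOpen.measurableSet]
  gcongr
  exact hx N

end Cantor

/-! ### Matching clopen sets by moving points forward -/

section Matching

variable {X : Type*} [TopologicalSpace X] {T : X ≃ₜ X} {A B A' B' : Set X}

/-- `A` can be mapped homeomorphically onto `B` by moving every point strictly forward along its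
`T`-orbit. -/
def ForwardEquiv (T : X ≃ₜ X) (A B : Set X) : Prop :=
  ∃ f : X → X, ContinuousOn f A ∧ BijOn f A B ∧ ∀ x ∈ A, InFuture T x (f x)

lemma ForwardEquiv.empty (T : X ≃ₜ X) : ForwardEquiv T (∅ : Set X) ∅ :=
  ⟨id, continuousOn_empty _, bijOn_empty _, fun _ h => h.elim⟩

lemma ForwardEquiv.image_pow (T : X ≃ₜ X) (A : Set X) {n : ℕ} (hn : 0 < n) :
    ForwardEquiv T A ((T ^ n) '' A) :=
  ⟨(T ^ n : X ≃ₜ X), (T ^ n).continuous.continuousOn, (T ^ n).injective.injOn.bijOn_image,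
    fun _ _ => ⟨n, hn, rfl⟩⟩

lemma ForwardEquiv.union (h : ForwardEquiv T A B) (h' : ForwardEquiv T A' B') (hA : IsClopen A)
    (hA' : IsClopen A') (hd : Disjoint A A') (hd' : Disjoint B B') :
    ForwardEquiv T (A ∪ A') (B ∪ B') := by
  classical
  obtain ⟨f, hf, hfb, hfT⟩ := h
  obtain ⟨f', hf', hfb', hfT'⟩ := h'
  have e1 : EqOn (A.piecewise f f') f A := piecewise_eqOn _ _ _
  have e2 : EqOn (A.piecewise f f') f' A' := fun x hx =>
    piecewise_eq_of_notMem _ _ _ (disjoint_right.1 hd hx)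
  have b1 := hfb.congr e1.symm
  have b2 := hfb'.congr e2.symm
  refine ⟨A.piecewise f f', (hf.congr e1).union_of_isOpen (hf'.congr e2) hA.isOpen hA'.isOpen,
    b1.union b2 ?_, ?_⟩
  · rw [injOn_union hd]
    refine ⟨b1.injOn, b2.injOn, fun x hx y hy h => ?_⟩
    exact disjoint_left.1 hd' (b1.mapsTo hx) (h ▸ b2.mapsTo hy)
  · rintro x (hx | hx)
    · rw [e1 hx]; exact hfT x hx
    · rw [e2 hx]; exact hfT' x hx

lemma ForwardEquiv.symm [CompactSpace X] [T2Space X] (h : ForwardEquiv T A B) (hA : IsClosed A) :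
    ForwardEquiv T⁻¹ B A := by
  obtain ⟨f, hf, hfb, hfT⟩ := h
  rcases A.eq_empty_or_nonempty with rfl | ⟨a, -⟩
  · have : B = ∅ := by simpa using hfb.image_eq.symm
    rw [this]
    exact ForwardEquiv.empty _
  have : Nonempty X := ⟨a⟩
  have hinv : InvOn (Function.invFunOn f A) f A B := hfb.invOn_invFunOn
  have hb : BijOn (Function.invFunOn f A) B A := hfb.symm hinv.symm
  refine ⟨_, ?_, hb, fun y hy => ?_⟩
  · refine continuousOn_iff_isClosed.2 fun F hF => ?_
    refine ⟨f '' (A ∩ F), ?_, ?_⟩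
    · exact ((hA.inter hF).isCompact.image_of_continuousOn (hf.mono inter_subset_left)).isClosed
    · ext y
      constructor
      · rintro ⟨h1, h2⟩
        exact ⟨⟨_, ⟨hb.mapsTo h2, h1⟩, hinv.2 h2⟩, h2⟩
      · rintro ⟨⟨x, ⟨hx, hxF⟩, rfl⟩, h2⟩
        refine ⟨?_, h2⟩
        rw [mem_preimage, hinv.1 hx]
        exact hxF
  · have := (hfT _ (hb.mapsTo hy)).inv
    rwa [hinv.2 hy] at this

/-- The greedy matching: at stage `n + 1`, every still unmatched point `x` of `A` for which
`T ^ (n + 1) x` is a still unmatched point of `B` is matched to it. The two components are the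
unmatched parts of `A` and of `B`. -/
def unmatched (T : X ≃ₜ X) (A B : Set X) : ℕ → Set X × Set X
  | 0 => (A, B)
  | n + 1 =>
    ((unmatched T A B n).1 \ (T ^ (n + 1)) ⁻¹' (unmatched T A B n).2,
      (unmatched T A B n).2 \ (T ^ (n + 1)) '' (unmatched T A B n).1)

lemma unmatched_fst_succ (n : ℕ) : (unmatched T A B (n + 1)).1 =
    (unmatched T A B n).1 \ (T ^ (n + 1)) ⁻¹' (unmatched T A B n).2 := rfl

lemma unmatched_snd_succ (n : ℕ) : (unmatched T A B (n + 1)).2 =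
    (unmatched T A B n).2 \ (T ^ (n + 1)) '' (unmatched T A B n).1 := rfl

lemma unmatched_fst_antitone : Antitone fun n => (unmatched T A B n).1 :=
  antitone_nat_of_succ_le fun _ => sdiff_subset

lemma unmatched_snd_antitone : Antitone fun n => (unmatched T A B n).2 :=
  antitone_nat_of_succ_le fun _ => sdiff_subset

lemma isClopen_unmatched (hA : IsClopen A) (hB : IsClopen B) (n : ℕ) :
    IsClopen (unmatched T A B n).1 ∧ IsClopen (unmatched T A B n).2 := by
  induction n with
  | zero => exact ⟨hA, hB⟩
  | succ n ih =>
    exact ⟨ih.1.diff (ih.2.preimage (T ^ (n + 1)).continuous),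
      ih.2.diff ⟨(T ^ (n + 1)).isClosedMap _ ih.1.1, (T ^ (n + 1)).isOpenMap _ ih.1.2⟩⟩

lemma forwardEquiv_matched (hA : IsClopen A) (hB : IsClopen B) (n : ℕ) :
    ForwardEquiv T (A \ (unmatched T A B n).1) (B \ (unmatched T A B n).2) := by
  induction n with
  | zero =>
    change ForwardEquiv T (A \ A) (B \ B)
    rw [sdiff_self, sdiff_self]
    exact ForwardEquiv.empty T
  | succ n ih =>
    obtain ⟨h1, h2⟩ := isClopen_unmatched (T := T) hA hB n
    set An := (unmatched T A B n).1
    set Bn := (unmatched T A B n).2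
    have hAn : An ⊆ A := unmatched_fst_antitone n.zero_le
    have hBn : Bn ⊆ B := unmatched_snd_antitone n.zero_le
    have hE : IsClopen (An ∩ (T ^ (n + 1)) ⁻¹' Bn) :=
      h1.inter (h2.preimage (T ^ (n + 1)).continuous)
    have h := ih.union (ForwardEquiv.image_pow T (An ∩ (T ^ (n + 1)) ⁻¹' Bn) n.succ_pos)
      (hA.diff h1) hE (disjoint_left.2 fun x hx hx' => hx.2 hx'.1) (by
        refine disjoint_left.2 ?_
        rintro _ hx ⟨y, hy, rfl⟩
        exact hx.2 hy.2)
    convert h using 1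
    · ext x
      change x ∈ A \ (An \ (T ^ (n + 1)) ⁻¹' Bn) ↔ _
      have := @hAn x
      simp only [Set.mem_sdiff, mem_union, mem_inter_iff]
      tauto
    · rw [image_inter_preimage]
      ext x
      change x ∈ B \ (Bn \ (T ^ (n + 1)) '' An) ↔ _
      have := @hBn x
      simp only [Set.mem_sdiff, mem_union, mem_inter_iff]
      tauto

/-- If a point of `A` is still unmatched after `N` stages, then the points of `B` among its next `N`
iterates have been matched to points of `A` strictly in between, so that `A` is visited at least as
often as `B`. -/
lemma visits_le_of_mem_unmatched {N : ℕ} {x : X} (hx : x ∈ (unmatched T A B N).1) :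
    visits T B N x ≤ visits T A N x := by
  classical
  rcases N with _ | N
  · simp [visits]
  have hxA : x ∈ A := unmatched_fst_antitone (Nat.zero_le (N + 1)) hx
  have key : ∀ n, n < N → (T ^ (n + 1)) x ∈ B → ∃ i < N, ∃ m, n = i + 1 + m ∧
      (T ^ (i + 1)) x ∈ (unmatched T A B m).1 ∧ (T ^ (i + 1)) x ∉ (unmatched T A B (m + 1)).1 := by
    intro n hn hB
    have hun : (T ^ (n + 1)) x ∉ (unmatched T A B n).2 := by
      have h : x ∈ (unmatched T A B (n + 1)).1 := unmatched_fst_antitone (by omega) hx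
      exact h.2
    obtain ⟨m, hm, hm1, hm2⟩ : ∃ m < n, (T ^ (n + 1)) x ∈ (unmatched T A B m).2 ∧
        (T ^ (n + 1)) x ∉ (unmatched T A B (m + 1)).2 := by
      by_contra! hcon
      have : ∀ m ≤ n, (T ^ (n + 1)) x ∈ (unmatched T A B m).2 := by
        intro m
        induction m with
        | zero => exact fun _ => hB
        | succ m ih => exact fun hm => hcon m (by omega) (ih (by omega))
      exact hun (this n le_rfl)
    rw [unmatched_snd_succ, Set.mem_sdiff, not_and, not_not] at hm2
    obtain ⟨y, hy, hyx⟩ := hm2 hm1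
    have hyT : y = (T ^ (n - m - 1 + 1)) x := by
      refine (T ^ (m + 1)).injective ?_
      rw [hyx, ← Homeomorph.mul_apply, ← pow_add]
      congr 2
      omega
    refine ⟨n - m - 1, by omega, m, by omega, hyT ▸ hy, ?_⟩
    rw [← hyT, unmatched_fst_succ]
    exact fun h => h.2 (by rw [mem_preimage, hyx]; exact hm1)
  -- each visit to `B` at time `n + 1` is charged to the visit to `A` at time `i + 1`
  have hcard : ∑ n ∈ Finset.range N, (if (T ^ (n + 1)) x ∈ B then 1 else 0) ≤
      ∑ i ∈ Finset.range N, (if (T ^ (i + 1)) x ∈ A then 1 else 0) := by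
    rw [← Finset.card_filter, ← Finset.card_filter]
    refine Finset.card_le_card_of_forall_subsingleton
      (fun n i => ∃ m, n = i + 1 + m ∧ (T ^ (i + 1)) x ∈ (unmatched T A B m).1 ∧
        (T ^ (i + 1)) x ∉ (unmatched T A B (m + 1)).1) ?_ ?_
    · intro n hn
      obtain ⟨h1, h2⟩ := Finset.mem_filter.1 hn
      obtain ⟨i, hi, m, hm, hm1, hm2⟩ := key n (Finset.mem_range.1 h1) h2
      refine ⟨i, Finset.mem_filter.2 ⟨Finset.mem_range.2 hi, ?_⟩, m, hm, hm1, hm2⟩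
      exact unmatched_fst_antitone m.zero_le hm1
    · rintro i - n ⟨-, m, rfl, hm1, hm2⟩ n' ⟨-, m', rfl, hm1', hm2'⟩
      have h1 : ¬ m + 1 ≤ m' := fun h => hm2 (unmatched_fst_antitone h hm1')
      have h2 : ¬ m' + 1 ≤ m := fun h => hm2' (unmatched_fst_antitone h hm1)
      omega
  have hA0 : (if (T ^ 0) x ∈ A then 1 else 0) = 1 := if_pos hxA
  have hB0 : (if (T ^ 0) x ∈ B then 1 else 0) ≤ 1 := by split_ifs <;> simp
  unfold visits
  rw [Finset.sum_range_succ', Finset.sum_range_succ', hA0]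
  exact add_le_add hcard hB0

/-- A clopen set that is visited less often than `B` along all orbit segments of some length can be
moved forward into `B`. -/
lemma exists_forwardEquiv_of_visits_lt (hA : IsClopen A) (hB : IsClopen B) {N : ℕ}
    (h : ∀ x, visits T A N x < visits T B N x) :
    ∃ I ⊆ B, IsClopen I ∧ ForwardEquiv T A I := by
  refine ⟨B \ (unmatched T A B N).2, sdiff_subset, hB.diff (isClopen_unmatched hA hB N).2, ?_⟩
  have h0 : (unmatched T A B N).1 = ∅ :=
    eq_empty_of_forall_notMem fun x hx => (h x).not_ge (visits_le_of_mem_unmatched hx)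
  have := forwardEquiv_matched (T := T) hA hB N
  rwa [h0, sdiff_empty] at this

end Matching

/-! ### Sets of equal measure are equivalent by forward moves -/

lemma eq_of_mem_layers {X : Type*} {A : ℕ → Set X} (hA : Antitone A) {x : X} {m n : ℕ}
    (hm : x ∈ A m \ A (m + 1)) (hn : x ∈ A n \ A (n + 1)) : m = n := by
  have h1 : ¬ m + 1 ≤ n := fun h => hm.2 (hA h hn.1)
  have h2 : ¬ n + 1 ≤ m := fun h => hn.2 (hA h hm.1)
  omega

lemma exists_mem_layer {X : Type*} [TopologicalSpace X] [IsCantorSpace X]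
    {D : ℕ → DiscreteQuotient X} (hcof : ∀ Q, ∃ n, D n ≤ Q) {A : ℕ → Set X}
    {a : X} (hAD : ∀ n, ∀ x ∈ A (n + 1), (D n).proj x = (D n).proj a) {x : X} (hx : x ∈ A 0)
    (hxa : x ≠ a) : ∃ n, x ∈ A n \ A (n + 1) := by
  by_contra! hcon
  have hall : ∀ n, x ∈ A n := by
    intro n
    induction n with
    | zero => exact hx
    | succ n ih => exact not_not.1 fun h => hcon n ⟨ih, h⟩
  refine hxa (DiscreteQuotient.eq_of_forall_proj_eq fun Q => ?_)
  obtain ⟨n, hn⟩ := hcof Q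
  exact proj_eq_of_le hn (hAD n x (hall _))

section Exact

variable {X : Type*} [TopologicalSpace X] [IsCantorSpace X] [MeasurableSpace X] [BorelSpace X]
  {T : X ≃ₜ X} {A B : Set X}

lemma ForwardEquiv.measureEq (h : ForwardEquiv T A B) (hA : IsClopen A) (hB : IsClopen B) :
    MeasureEq T A B := by
  have key : ∀ {T : X ≃ₜ X} {A B : Set X}, ForwardEquiv T A B → IsClopen A →
      ∀ μ : Measure X, IsInvariantProb T μ → μ B ≤ μ A := by
    rintro T A B ⟨f, hf, hfb, hfT⟩ hA μ hμ
    rw [← hfb.image_eq]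
    exact hμ.measure_image_le hA hf fun x hx => (hfT x hx).mem_orbit
  exact fun μ hμ => le_antisymm (key (h.symm hA.isClosed) hB μ hμ.inv) (key h hA μ hμ)

/-- All of `A` but an arbitrary nonempty clopen part can be moved forward into `B`, avoiding a given
point. -/
lemma MeasureEq.exists_forwardEquiv_diff (hT : HasDenseOrbits T) (h : MeasureEq T A B)
    (hA : IsClopen A) (hB : IsClopen B) {U : Set X} (hU : IsClopen U) (hUA : U ⊆ A)
    (hne : U.Nonempty) {b : X} (hb : b ∈ B) :
    ∃ I ⊆ B, IsClopen I ∧ b ∉ I ∧ ForwardEquiv T (A \ U) I := by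
  obtain ⟨V, hV, hbV, hVB, hVU⟩ := hT.exists_small_nhd hU.isOpen hne hB.isOpen hb
  have hlt : MeasureLT T (A \ U) (B \ V) := by
    intro μ hμ
    have := hμ.prob
    by_contra hle
    have h1 := ENNReal.add_lt_add_of_le_of_lt (measure_ne_top μ (B \ V)) (not_lt.1 hle) (hVU μ hμ)
    have hAU := measure_sdiff_add_inter (μ := μ) A hU.isOpen.measurableSet
    have hBV := measure_sdiff_add_inter (μ := μ) B hV.isOpen.measurableSet
    rw [inter_eq_self_of_subset_right hUA] at hAU
    rw [inter_eq_self_of_subset_right hVB] at hBV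
    rw [hAU, hBV, h μ hμ] at h1
    exact h1.false
  obtain ⟨N, hN⟩ := hlt.exists_visits_lt (hA.diff hU) (hB.diff hV)
  obtain ⟨I, hI, hIc, hAI⟩ := exists_forwardEquiv_of_visits_lt (hA.diff hU) (hB.diff hV) hN
  exact ⟨I, hI.trans sdiff_subset, hIc, fun h => (hI h).2 hbV, hAI⟩

/-- One round of the back-and-forth: up to small neighbourhoods of two given points, `A` and `B` are
matched by forward moves. First most of `A` is moved forward into `B`, then most of what is left of
`B` is moved backward into what is left of `A`. -/
lemma MeasureEq.exists_shrink (hT : HasDenseOrbits T) (h : MeasureEq T A B)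
    (hA : IsClopen A) (hB : IsClopen B) {a b : X} (ha : a ∈ A) (hb : b ∈ B) {U V : Set X}
    (hU : IsClopen U) (hV : IsClopen V) (haU : a ∈ U) (hbV : b ∈ V) :
    ∃ A' B', IsClopen A' ∧ IsClopen B' ∧ a ∈ A' ∧ b ∈ B' ∧ A' ⊆ A ∩ U ∧ B' ⊆ B ∩ V ∧
      MeasureEq T A' B' ∧ ForwardEquiv T (A \ A') (B \ B') := by
  have hAU : IsClopen (A ∩ U) := hA.inter hU
  obtain ⟨I, hIB, hI, hbI, hAI⟩ :=
    h.exists_forwardEquiv_diff hT hA hB hAU inter_subset_left ⟨a, ha, haU⟩ hb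
  have h1 : MeasureEq T (A ∩ U) (B \ I) := by
    have := h.diff (hAI.measureEq (hA.diff hAU) hI) (hA.diff hAU) hI sdiff_subset hIB
    rwa [sdiff_sdiff_cancel_left inter_subset_left] at this
  have hBI : IsClopen (B \ I) := hB.diff hI
  have hV' : IsClopen ((B \ I) ∩ V) := hBI.inter hV
  have h1' : MeasureEq T⁻¹ (B \ I) (A ∩ U) :=
    fun μ hμ => (h1 μ (isInvariantProb_inv_iff.1 hμ)).symm
  obtain ⟨J, hJU, hJ, haJ, hJV⟩ :=
    h1'.exists_forwardEquiv_diff hT.inv hBI hAU hV' inter_subset_left ⟨b, ⟨hb, hbI⟩, hbV⟩ ⟨ha, haU⟩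
  have hJV' := hJV.symm (hBI.diff hV').isClosed
  rw [inv_inv] at hJV'
  refine ⟨(A ∩ U) \ J, (B \ I) ∩ V, hAU.diff hJ, hV', ⟨⟨ha, haU⟩, haJ⟩, ⟨⟨hb, hbI⟩, hbV⟩,
    sdiff_subset, fun x hx => ⟨hx.1.1, hx.2⟩, ?_, ?_⟩
  · have := h1.diff (hJV'.measureEq hJ (hBI.diff hV')) hJ (hBI.diff hV') hJU sdiff_subset
    rwa [sdiff_sdiff_cancel_left inter_subset_left] at this
  · have := hAI.union hJV' (hA.diff hAU) hJ (disjoint_left.2 fun x hx hx' => hx.2 (hJU hx'))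
      (disjoint_left.2 fun x hx hx' => hx'.1.2 hx)
    convert this using 1
    · ext x
      have := @hJU x
      simp only [Set.mem_sdiff, mem_union, mem_inter_iff] at this ⊢
      tauto
    · ext x
      have := @hIB x
      simp only [Set.mem_sdiff, mem_union, mem_inter_iff] at this ⊢
      tauto

/-- Clopen sets of equal measure are equivalent by forward moves. The partial maps from the rounds
of the back-and-forth fit together outside the two limit points `a` and `b`, and the map
extends by `a ↦ b`. -/
lemma MeasureEq.forwardEquiv (hT : HasDenseOrbits T) (h : MeasureEq T A B)
    (hA : IsClopen A) (hB : IsClopen B) {a b : X} (ha : a ∈ A) (hb : b ∈ B)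
    (hab : InFuture T a b) : ForwardEquiv T A B := by
  classical
  obtain ⟨D, -, hcof⟩ := exists_cofinal_partitions X
  let State := {p : Set X × Set X //
    IsClopen p.1 ∧ IsClopen p.2 ∧ a ∈ p.1 ∧ b ∈ p.2 ∧ MeasureEq T p.1 p.2}
  have hnext : ∀ (n : ℕ) (p : State), ∃ q : State,
      q.1.1 ⊆ p.1.1 ∩ (D n).proj ⁻¹' {(D n).proj a} ∧
      q.1.2 ⊆ p.1.2 ∩ (D n).proj ⁻¹' {(D n).proj b} ∧
      ForwardEquiv T (p.1.1 \ q.1.1) (p.1.2 \ q.1.2) := by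
    rintro n ⟨p, hp1, hp2, hpa, hpb, hp⟩
    obtain ⟨A', B', h1, h2, h3, h4, h5, h6, h7, h8⟩ := hp.exists_shrink hT hp1 hp2 hpa hpb
      ((D n).isClopen_preimage {(D n).proj a}) ((D n).isClopen_preimage {(D n).proj b}) rfl rfl
    exact ⟨⟨(A', B'), h1, h2, h3, h4, h7⟩, h5, h6, h8⟩
  choose next hnA hnB hnF using hnext
  let s : ℕ → State := fun n => Nat.rec ⟨(A, B), hA, hB, ha, hb, h⟩ next n
  let As : ℕ → Set X := fun n => (s n).1.1
  let Bs : ℕ → Set X := fun n => (s n).1.2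
  have hAsm : Antitone As := antitone_nat_of_succ_le fun n x hx => (hnA n (s n) hx).1
  have hBsm : Antitone Bs := antitone_nat_of_succ_le fun n x hx => (hnB n (s n) hx).1
  have hAD : ∀ n, ∀ x ∈ As (n + 1), (D n).proj x = (D n).proj a :=
    fun n x hx => (hnA n (s n) hx).2
  have hBD : ∀ n, ∀ x ∈ Bs (n + 1), (D n).proj x = (D n).proj b :=
    fun n x hx => (hnB n (s n) hx).2
  have hAc : ∀ n, IsClopen (As n) := fun n => (s n).2.1
  have haA : ∀ n, a ∈ As n := fun n => (s n).2.2.2.1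
  have hbB : ∀ n, b ∈ Bs n := fun n => (s n).2.2.2.2.1
  choose f hfc hfb hfT using fun n => (hnF n (s n) : ForwardEquiv T (As n \ As (n + 1))
    (Bs n \ Bs (n + 1)))
  let F : X → X := fun x => if hx : ∃ n, x ∈ As n \ As (n + 1) then f hx.choose x else b
  have hFf : ∀ {n x}, x ∈ As n \ As (n + 1) → F x = f n x := by
    intro n x hx
    have hex : ∃ n, x ∈ As n \ As (n + 1) := ⟨n, hx⟩
    change (if hx : ∃ n, x ∈ As n \ As (n + 1) then f hx.choose x else b) = _
    rw [dif_pos hex, eq_of_mem_layers hAsm hex.choose_spec hx]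
  have hFa : F a = b := dif_neg fun ⟨n, hn⟩ => hn.2 (haA (n + 1))
  have hlayer : ∀ {n x}, x ∈ As n \ As (n + 1) → F x ∈ Bs n \ Bs (n + 1) :=
    fun hx => hFf hx ▸ (hfb _).mapsTo hx
  have hmaps : ∀ n, MapsTo F (As n) (Bs n) := by
    intro n x hx
    by_cases hxa : x = a
    · rw [hxa, hFa]
      exact hbB n
    · obtain ⟨m, hm⟩ := exists_mem_layer hcof hAD (hAsm n.zero_le hx) hxa
      have hnm : n ≤ m := by
        by_contra hlt
        exact hm.2 (hAsm (not_le.1 hlt) hx)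
      exact hBsm hnm (hlayer hm).1
  have hFb : ∀ {n x}, x ∈ As n \ As (n + 1) → F x ≠ b :=
    fun {n _} hx h => (hlayer hx).2 (h ▸ hbB (n + 1))
  refine ⟨F, ?_, ⟨hmaps 0, ?_, ?_⟩, ?_⟩
  · refine continuousOn_of_forall_continuousAt fun x hx => ?_
    by_cases hxa : x = a
    · subst hxa
      intro N hN
      rw [hFa] at hN
      obtain ⟨O, hON, hO, hbO⟩ := mem_nhds_iff.1 hN
      obtain ⟨W, hW, hbW, hWO⟩ := exists_isClopen_mem_subset hO hbO
      obtain ⟨n, hn⟩ := hcof (DiscreteQuotient.ofIsClopen hW)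
      rw [mem_map]
      filter_upwards [(hAc (n + 1)).isOpen.mem_nhds (haA (n + 1))] with y hy
      have := hBD n (F y) (hmaps (n + 1) hy)
      exact hON (hWO (((proj_ofIsClopen_eq_iff hW).1
        (proj_eq_of_le hn this)).2 hbW))
    · obtain ⟨n, hn⟩ := exists_mem_layer hcof hAD hx hxa
      have hnhds : As n \ As (n + 1) ∈ 𝓝 x := ((hAc n).diff (hAc (n + 1))).isOpen.mem_nhds hn
      refine ((hfc n).continuousAt hnhds).congr ?_
      filter_upwards [hnhds] with y hy
      exact (hFf hy).symm
  · intro x hx y hy hxy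
    by_cases hxa : x = a <;> by_cases hya : y = a
    · rw [hxa, hya]
    · obtain ⟨n, hn⟩ := exists_mem_layer hcof hAD hy hya
      exact absurd (by rw [← hxy, hxa, hFa]) (hFb hn)
    · obtain ⟨n, hn⟩ := exists_mem_layer hcof hAD hx hxa
      exact absurd (by rw [hxy, hya, hFa]) (hFb hn)
    · obtain ⟨n, hn⟩ := exists_mem_layer hcof hAD hx hxa
      obtain ⟨m, hm⟩ := exists_mem_layer hcof hAD hy hya
      obtain rfl : n = m := eq_of_mem_layers hBsm (hlayer hn) (hxy ▸ hlayer hm)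
      exact (hfb n).injOn hn hm (by rw [← hFf hn, ← hFf hm, hxy])
  · intro y hy
    by_cases hyb : y = b
    · exact ⟨a, ha, by rw [hFa, hyb]⟩
    · obtain ⟨n, hn⟩ := exists_mem_layer hcof hBD hy hyb
      obtain ⟨x, hx, rfl⟩ := (hfb n).surjOn hn
      exact ⟨x, hAsm n.zero_le hx.1, hFf hx⟩
  · intro x hx
    by_cases hxa : x = a
    · rw [hxa, hFa]
      exact hab
    · obtain ⟨n, hn⟩ := exists_mem_layer hcof hAD hx hxa
      rw [hFf hn]
      exact hfT n x hn

end Exact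

/-! ### Making an element of the full group move points forward -/

section Step

variable {X : Type*} [TopologicalSpace X] [IsCantorSpace X] {T S : X ≃ₜ X}

/-- Precomposing `S` with a homeomorphism supported on a clopen set `E` makes it move the points
of `E` forward. -/
lemma exists_forward_on (hT : HasDenseOrbits T) (hS : S ∈ fullGroup T) {E : Set X}
    (hE : IsClopen E) : ∃ τ ∈ fullGroup T, (∀ x, x ∉ E → τ x = x) ∧ (∀ x ∈ E, τ x ∈ E) ∧
      ∀ x ∈ E, InFuture T x (S (τ x)) := by
  classical
  rcases E.eq_empty_or_nonempty with rfl | ⟨a, ha⟩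
  · exact ⟨1, one_mem _, fun _ _ => rfl, fun _ h => h.elim, fun _ h => h.elim⟩
  let _ : MeasurableSpace X := borel X
  have : BorelSpace X := ⟨rfl⟩
  have hSE : IsClopen (S '' E) := ⟨S.isClosedMap _ hE.1, S.isOpenMap _ hE.2⟩
  obtain ⟨b, hb, hab⟩ := hT.exists_inFuture hSE.isOpen ⟨S a, a, ha, rfl⟩ a
  obtain ⟨f, hf, hfb, hfT⟩ := (MeasureEq.of_mem_fullGroup hS hE).forwardEquiv hT hE hSE ha hb hab
  set G : X → X := E.piecewise (fun x => S⁻¹ (f x)) id with hG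
  have e1 : EqOn G (fun x => S⁻¹ (f x)) E := piecewise_eqOn _ _ _
  have e2 : EqOn G id Eᶜ := piecewise_eqOn_compl _ _ _
  have hSinv : BijOn (S⁻¹ : X ≃ₜ X) (S '' E) E := S.toEquiv.bijOn_symm_image
  have b1 : BijOn G E E := (hSinv.comp hfb).congr e1.symm
  have b2 : BijOn G Eᶜ Eᶜ := (bijOn_id _).congr e2.symm
  have hbij : G.Bijective := by
    rw [← bijOn_univ, ← union_compl_self E]
    refine b1.union b2 ((injOn_union disjoint_compl_right).2 ⟨b1.injOn, b2.injOn, ?_⟩)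
    exact fun x hx y hy h => b2.mapsTo hy (h ▸ b1.mapsTo hx)
  have hcont : Continuous G := by
    rw [← continuousOn_univ, ← union_compl_self E]
    exact ((S⁻¹.continuous.comp_continuousOn hf).congr e1).union_of_isOpen
      (continuousOn_id.congr e2) hE.isOpen hE.compl.isOpen
  let τ : X ≃ₜ X := Continuous.homeoOfEquivCompactToT2 (f := Equiv.ofBijective G hbij) hcont
  have hτ : ∀ x, τ x = G x := fun _ => rfl
  have hSτ : ∀ x ∈ E, S (τ x) = f x := fun x hx => by
    rw [hτ, e1 hx, ← Homeomorph.mul_apply, mul_inv_cancel, Homeomorph.one_apply]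
  refine ⟨τ, fun x => ?_, fun x hx => e2 hx, fun x hx => b1.mapsTo hx, fun x hx => ?_⟩
  · by_cases hx : x ∈ E
    · have h1 : S (τ x) ∈ orbit T x := hSτ x hx ▸ (hfT x hx).mem_orbit
      exact orbit_trans h1 (orbit_symm (hS (τ x)))
    · rw [show τ x = x from e2 hx]
      exact orbit_refl T x
  · rw [hSτ x hx]
    exact hfT x hx

/-- The correction of `exists_forward_on` can be taken to preserve the cells of a given
partition. -/
lemma exists_forward_on_cells (hT : HasDenseOrbits T) (hS : S ∈ fullGroup T) {E : Set X}
    (hE : IsClopen E) (R : DiscreteQuotient X) :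
    ∃ τ ∈ fullGroup T, τ ∈ cellStabilizer R ∧ (∀ x, x ∉ E → τ x = x) ∧
      ∀ x ∈ E, InFuture T x (S (τ x)) := by
  choose t htT htE htE' htS using fun c : R =>
    exists_forward_on hT hS (hE.inter (R.isClopen_preimage {c}))
  obtain ⟨τ, hτR, hτ⟩ := exists_glue R (fun x => t (R.proj x)) (fun x y h => by rw [h])
    (fun x y => by
      by_cases hy : y ∈ E ∩ R.proj ⁻¹' {R.proj x}
      · exact (htE' _ y hy).2.trans hy.2.symm
      · rw [htE _ y hy])
  refine ⟨τ, fun x => ?_, hτR, fun x hx => ?_, fun x hx => ?_⟩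
  · rw [hτ]
    exact htT _ x
  · rw [hτ]
    exact htE _ x fun h => hx h.1
  · rw [hτ]
    exact htS _ x ⟨hx, rfl⟩

/-- The inductive step. If `S` moves points forward outside `C`, then a conjugate of `S` agrees with
`S` outside `C`, still maps `x₀` to `S x₀`, and moves points forward outside the smaller set `C'`.
The conjugating homeomorphism is `x ↦ (S τ) ^ d x (S ^ (-d x) x)`, where `τ` corrects `S` on
`C \ C'` and `d` is a height function over `C'`; it is as close to the identity as desired. -/
lemma exists_conj_forward (hT : HasDenseOrbits T) (hS : S ∈ fullGroup T) (hSd : HasDenseOrbits S)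
    {C C' : Set X} (hC : IsClopen C) (hC' : IsClopen C') (hCC' : C' ⊆ C) {x₀ : X} (hx₀ : x₀ ∈ C')
    (hfwd : ∀ x, x ∉ C → InFuture T x (S x)) (Q : DiscreteQuotient X) :
    ∃ k ∈ fullGroup T, k ∈ cellStabilizer Q ∧ (k * S * k⁻¹) x₀ = S x₀ ∧
      (∀ x, x ∉ C → (k * S * k⁻¹) x = S x) ∧
      ∀ x, x ∉ C' → InFuture T x ((k * S * k⁻¹) x) := by
  obtain ⟨d, hd, hd0, hdS0, hdS⟩ := hSd.exists_height hC' hx₀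
  let dQ : DiscreteQuotient X := (⟨d, hd⟩ : LocallyConstant X ℤ).discreteQuotient
  have hdQ : ∀ {x y}, dQ.proj x = dQ.proj y → d x = d y := fun h => Quotient.eq''.1 h
  obtain ⟨N, hN⟩ : ∃ N : ℕ, ∀ x, |d x| ≤ N := by
    obtain ⟨M, hM⟩ := (hd.range_finite.image fun m : ℤ => m.natAbs).bddAbove
    refine ⟨M, fun x => ?_⟩
    rw [Int.abs_eq_natAbs]
    exact_mod_cast hM ⟨d x, ⟨x, rfl⟩, rfl⟩
  set P : DiscreteQuotient X := Q ⊓ (dQ ⊓ DiscreteQuotient.ofIsClopen hC')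
  have hPd : P ≤ dQ := inf_le_right.trans inf_le_left
  obtain ⟨R, hR⟩ := exists_perturbation S P N
  obtain ⟨τ, hτT, hτR, hτ, hτf⟩ := exists_forward_on_cells hT hS (hC.diff hC') R
  set φ : ℤ → X ≃ₜ X := fun m => (S * τ) ^ m * S ^ (-m) with hφ
  obtain ⟨k, hkP, hk⟩ := exists_glue P (fun x => φ (d x))
    (fun x y h => by rw [hdQ (proj_eq_of_le hPd h)])
    (fun x => hR τ hτR (d x) (hN x))
  have hkC' : ∀ x, k⁻¹ x ∈ C' ↔ x ∈ C' := fun x => (proj_ofIsClopen_eq_iff hC').1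
    (proj_eq_of_le (inf_le_right.trans inf_le_right) (inv_mem hkP x))
  have hfix : ∀ x, d x = 0 → k x = x := fun x hx => by
    rw [hk, hx]
    simp [hφ]
  have hkinv : ∀ x, k (k⁻¹ x) = x := fun x => by
    rw [← Homeomorph.mul_apply, mul_inv_cancel, Homeomorph.one_apply]
  -- `d (S y) = d y + 1` for `y ∉ C'`, so that `k` intertwines `S` and `S τ` there
  have hSk : ∀ x, x ∉ C' → (k * S * k⁻¹) x = S (τ x) := by
    intro x hx
    set y := k⁻¹ x with hy
    have hyC : y ∉ C' := fun h => hx ((hkC' x).1 h)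
    have h1 : (k * S * k⁻¹) x = φ (d y + 1) (S y) := by
      rw [← hdS y hyC, ← hk]
      rfl
    have h2 : φ (d y + 1) (S y) = (S * τ) (φ (d y) y) := by
      simp only [hφ, ← Homeomorph.mul_apply]
      congr 1
      rw [add_comm (d y) 1, zpow_add, zpow_one]
      group
    rw [h1, h2, ← hk, hkinv]
    rfl
  refine ⟨k, fun x => ?_, cellStabilizer_mono inf_le_left hkP, ?_, fun x hx => ?_, fun x hx => ?_⟩
  · rw [hk]
    exact (fullGroup T).mul_mem ((fullGroup T).zpow_mem ((fullGroup T).mul_mem hS hτT) _)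
      ((fullGroup T).zpow_mem hS _) x
  · have : k⁻¹ x₀ = x₀ := by
      conv_lhs => rw [← hfix x₀ hd0]
      rw [← Homeomorph.mul_apply, inv_mul_cancel, Homeomorph.one_apply]
    change k (S (k⁻¹ x₀)) = S x₀
    rw [this, hfix _ hdS0]
  · rw [hSk x fun h => hx (hCC' h), hτ x fun h => hx h.1]
  · rw [hSk x hx]
    by_cases hxC : x ∈ C
    · exact hτf x ⟨hxC, hx⟩
    · rw [hτ x fun h => hxC h.1]
      exact hfwd x hxC

/-- Some conjugate of `S` by an element of the full group moves some point forward: if `S` moves `u`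
backward, exchange `u` and `S u`. -/
lemma exists_conj_inFuture (hS : S ∈ fullGroup T) (hSd : HasDenseOrbits S) :
    ∃ g ∈ fullGroup T, ∃ x, InFuture T x ((g * S * g⁻¹) x) := by
  classical
  obtain ⟨u⟩ := (inferInstance : Nonempty X)
  obtain ⟨n, hn⟩ := hS u
  have hSu : S u ≠ u := by
    intro h
    have := hSd.aperiodic (x := u) (n := 1) (by rwa [zpow_one])
    omega
  rcases lt_trichotomy n 0 with h | rfl | h
  · obtain ⟨m, rfl⟩ : ∃ m : ℕ, n = -(m : ℤ) := ⟨n.natAbs, by omega⟩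
    set V : X ≃ₜ X := T ^ m with hV
    have hVu : V (S u) = u := by
      rw [← hn, hV, ← zpow_natCast, ← Homeomorph.mul_apply, ← zpow_add, add_neg_cancel, zpow_zero,
        Homeomorph.one_apply]
    obtain ⟨O, O', hO, hO', huO, huO', hd⟩ := t2_separation hSu
    obtain ⟨W, hW, huW, hWs⟩ := exists_isClopen_mem_subset
      (hO.inter (hO'.preimage V.continuous)) (x := S u) ⟨huO, by rwa [mem_preimage, hVu]⟩
    have hVW : ∀ x ∈ W, V x ∉ W := fun x hx hx' =>
      disjoint_left.1 hd (hWs hx').1 (hWs hx).2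
    -- `W` is a neighbourhood of `S u` disjoint from `V '' W`; the involution `G` exchanges the two
    set G : X → X := fun x => if x ∈ W then V x else if V⁻¹ x ∈ W then V⁻¹ x else x with hG
    have hVi : ∀ x, V⁻¹ (V x) = x := V.symm_apply_apply
    have hVi' : ∀ x, V (V⁻¹ x) = x := V.apply_symm_apply
    have hGG : ∀ x, G (G x) = x := by
      intro x
      by_cases h1 : x ∈ W
      · have e : G x = V x := if_pos h1
        rw [e]
        simp only [hG, if_neg (hVW x h1), hVi, if_pos h1]
      · by_cases h2 : V⁻¹ x ∈ W
        · have e : G x = V⁻¹ x := (if_neg h1).trans (if_pos h2)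
          rw [e]
          simp only [hG, if_pos h2, hVi']
        · have e : G x = x := (if_neg h1).trans (if_neg h2)
          rw [e, e]
    have hGc : Continuous G := by
      have hW' : IsClopen ((V⁻¹ : X ≃ₜ X) ⁻¹' W) := hW.preimage V⁻¹.continuous
      refine V.continuous.if (fun x hx => ?_) (V⁻¹.continuous.if (fun x hx => ?_) continuous_id)
      · exact absurd hx (hW.frontier_eq ▸ notMem_empty x)
      · exact absurd hx (hW'.frontier_eq ▸ notMem_empty x)
    let g : X ≃ₜ X := ⟨⟨G, G, hGG, hGG⟩, hGc, hGc⟩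
    have hgu : g u = S u := by
      have h1 : u ∉ W := fun h => hVW _ huW (hVu.symm ▸ h)
      have h2 : V⁻¹ u = S u := by rw [← hVu, hVi, hVu]
      change (if u ∈ W then V u else if V⁻¹ u ∈ W then V⁻¹ u else u) = S u
      rw [if_neg h1, h2, if_pos huW]
    have hgSu : g (S u) = u := (if_pos huW).trans hVu
    refine ⟨g, fun x => ?_, S u, m, by omega, ?_⟩
    · change (if x ∈ W then V x else if V⁻¹ x ∈ W then V⁻¹ x else x) ∈ _
      split_ifs
      · exact ⟨m, by rw [zpow_natCast]⟩
      · exact ⟨-m, by rw [zpow_neg, zpow_natCast]⟩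
      · exact orbit_refl T x
    · change V (S u) = g (S (g⁻¹ (S u)))
      have : g⁻¹ (S u) = u := by rw [← hgu]; exact g.symm_apply_apply u
      rw [this, hgSu, hVu]
  · exact absurd (hn.symm.trans (by simp)) hSu
  · refine ⟨1, one_mem _, u, n.toNat, by omega, ?_⟩
    rw [← zpow_natCast, Int.toNat_of_nonneg h.le, hn]
    simp

end Step

/-! ### Speedups in the full group -/

/-- Every element of the full group of `T` with dense orbits is, up to conjugacy, a speedup
of `T`. -/
theorem isSpeedup_of_mem_fullGroup {X : Type*} [TopologicalSpace X] [IsCantorSpace X]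
    {T S : X ≃ₜ X} (hT : HasDenseOrbits T) (hS : S ∈ fullGroup T) (hSd : HasDenseOrbits S) :
    IsSpeedup S T := by
  obtain ⟨g₀, hg₀, x₀, hx₀⟩ := exists_conj_inFuture hS hSd
  obtain ⟨D, hD, hcof⟩ := exists_cofinal_partitions X
  -- the points that need not be moved forward at stage `n`
  let C : ℕ → Set X := fun n => n.casesOn univ fun m => (D m).proj ⁻¹' {(D m).proj x₀}
  have hC : ∀ n, IsClopen (C n) := by
    rintro (_ | n)
    · exact isClopen_univ
    · exact (D n).isClopen_preimage _
  have hCanti : Antitone C := by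
    refine antitone_nat_of_succ_le ?_
    rintro (_ | n)
    · exact subset_univ _
    · exact fun x hx => proj_eq_of_le (hD n.le_succ) hx
  have hxC : ∀ n, x₀ ∈ C n := by
    rintro (_ | n)
    · exact mem_univ _
    · rfl
  set y₀ := (g₀ * S * g₀⁻¹) x₀ with hy₀
  let State : ℕ → Type _ := fun n => {g : X ≃ₜ X // g ∈ fullGroup T ∧ (g * S * g⁻¹) x₀ = y₀ ∧
    ∀ x, x ∉ C n → InFuture T x ((g * S * g⁻¹) x)}
  have hnext : ∀ n (g : State n), ∃ g' : State (n + 1),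
      (∀ x, (D n).proj (g'.1 x) = (D n).proj (g.1 x)) ∧
      (∀ x, (D n).proj (g'.1⁻¹ x) = (D n).proj (g.1⁻¹ x)) ∧
      ∀ x, x ∉ C n → (g'.1 * S * g'.1⁻¹) x = (g.1 * S * g.1⁻¹) x := by
    rintro n ⟨g, hgT, hgx, hgf⟩
    -- the second partition keeps the inverses close: `(k * g)⁻¹ = g⁻¹ * k⁻¹`
    obtain ⟨k, hkT, hkQ, hkx, hkC, hkf⟩ := exists_conj_forward hT
      (mul_mem (mul_mem hgT hS) (inv_mem hgT)) (hSd.conj g) (hC n) (hC (n + 1))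
      (hCanti n.le_succ) (hxC (n + 1)) hgf (D n ⊓ pullback g⁻¹ (D n))
    have hconj : (k * g) * S * (k * g)⁻¹ = k * (g * S * g⁻¹) * k⁻¹ := by group
    refine ⟨⟨k * g, mul_mem hkT hgT, ?_, ?_⟩, fun x => ?_, fun x => ?_, fun x hx => ?_⟩
    · rw [hconj, hkx, hgx]
    · rw [hconj]
      exact hkf
    · exact cellStabilizer_mono inf_le_left hkQ (g x)
    · change (D n).proj ((k * g)⁻¹ x) = (D n).proj (g⁻¹ x)
      rw [mul_inv_rev]
      exact pullback_proj_eq_iff.1 (cellStabilizer_mono inf_le_right (inv_mem hkQ) x)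
    · change ((k * g) * S * (k * g)⁻¹) x = (g * S * g⁻¹) x
      rw [hconj, hkC x hx]
  choose next hn1 hn2 hn3 using hnext
  let s : ∀ n, State n := fun n =>
    Nat.rec ⟨g₀, hg₀, rfl, fun x hx => absurd (mem_univ x) hx⟩ next n
  have hs1 : ∀ n x, (D n).proj ((s (n + 1)).1 x) = (D n).proj ((s n).1 x) := fun n => hn1 n (s n)
  have hs2 : ∀ n x, (D n).proj ((s (n + 1)).1⁻¹ x) = (D n).proj ((s n).1⁻¹ x) :=
    fun n => hn2 n (s n)
  have hs3 : ∀ n x, x ∉ C n → ∀ m, n ≤ m →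
      ((s m).1 * S * (s m).1⁻¹) x = ((s n).1 * S * (s n).1⁻¹) x := by
    intro n x hx m hm
    induction m, hm using Nat.le_induction with
    | base => rfl
    | succ m hm ih => exact (hn3 m (s m) x fun h => hx (hCanti hm h)).trans ih
  obtain ⟨h, hh1, hh2⟩ := exists_limit_homeomorph hD hcof (g := fun n => (s n).1) hs1 hs2
  have hlim := fun {y z : X} {n : ℕ} => conj_limit_apply hD hcof (g := fun n => (s n).1) hs1 hs2
    hh1 hh2 S (y := y) (z := z) (n := n)
  have hfwd : ∀ x, InFuture T x ((h * S * h⁻¹) x) := by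
    intro x
    by_cases hx : x = x₀
    · subst hx
      rw [hlim (n := 0) (z := y₀) fun m _ => (s m).2.2.1]
      exact hx₀
    · obtain ⟨n, hn⟩ : ∃ n, x ∉ C n := by
        by_contra! hall
        refine hx (DiscreteQuotient.eq_of_forall_proj_eq fun Q => ?_)
        obtain ⟨n, hn⟩ := hcof Q
        exact proj_eq_of_le hn (hall (n + 1))
      rw [hlim (hs3 n x hn)]
      exact (s n).2.2.2 x hn
  choose p hp hpT using hfwd
  refine ⟨p, hp, h⁻¹, fun x => ?_⟩
  change h⁻¹ ((T ^ p x) x) = S (h⁻¹ x)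
  rw [hpT]
  exact h.symm_apply_apply _

lemma AreConjugate.trans {X Y Z : Type*} [TopologicalSpace X] [TopologicalSpace Y]
    [TopologicalSpace Z] {f : X → X} {g : Y → Y} {k : Z → Z} (h₁ : AreConjugate f g)
    (h₂ : AreConjugate g k) : AreConjugate f k := by
  obtain ⟨a, ha⟩ := h₁
  obtain ⟨b, hb⟩ := h₂
  exact ⟨a.trans b, hb.comp_left ha⟩

lemma IsSpeedup.congr {X Y Z : Type*} [TopologicalSpace X] [TopologicalSpace Y]
    [TopologicalSpace Z] {T : X ≃ₜ X} {S : Y ≃ₜ Y} {R : Z ≃ₜ Z} (h : IsSpeedup S T)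
    (hSR : AreConjugate S R) : IsSpeedup R T := by
  obtain ⟨p, hp, hpS⟩ := h
  exact ⟨p, hp, hpS.trans hSR⟩

lemma isSpeedup_of_orbit_eq {X : Type*} [TopologicalSpace X] {T S : X ≃ₜ X}
    (hT : IsMinimalCantorSystem T) (h : ∀ x, orbit S x = orbit T x) : IsSpeedup S T := by
  have := hT.cantor
  refine isSpeedup_of_mem_fullGroup hT.dense_orbit (fun x => ?_) fun x => ?_
  · rw [← h]
    exact ⟨1, by rw [zpow_one]⟩
  · rw [h]
    exact hT.dense_orbit x

end CantorDynamics

theorem mainTheorem4 {X₁ X₂ : Type*} [TopologicalSpace X₁] [TopologicalSpace X₂]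
    (T₁ : X₁ ≃ₜ X₁) (T₂ : X₂ ≃ₜ X₂)
    (h₁ : CantorDynamics.IsMinimalCantorSystem T₁)
    (h₂ : CantorDynamics.IsMinimalCantorSystem T₂)
    (hOE : CantorDynamics.AreOrbitEquivalent T₁ T₂) :
    CantorDynamics.AreSpeedupEquivalent T₁ T₂ := by
  obtain ⟨T', hT', h, hh⟩ := hOE
  constructor
  · -- transport `T₁` to `X₂`, where it has the same orbits as `T₂`
    let R : X₂ ≃ₜ X₂ := (h.symm.trans T₁).trans h
    have hR : Function.Semiconj h T₁ R := fun x => by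
      change h (T₁ x) = h (T₁ (h.symm (h x)))
      rw [h.symm_apply_apply]
    have horb : ∀ y, CantorDynamics.orbit R y = CantorDynamics.orbit T₂ y := by
      intro y
      obtain ⟨x, rfl⟩ := h.surjective y
      rw [CantorDynamics.orbit_map_of_semiconj hR, CantorDynamics.orbit_map_of_semiconj hh, hT']
    refine (CantorDynamics.isSpeedup_of_orbit_eq h₂ horb).congr ⟨h.symm, fun y => ?_⟩
    change h.symm (h (T₁ (h.symm y))) = T₁ (h.symm y)
    rw [h.symm_apply_apply]
  · exact (CantorDynamics.isSpeedup_of_orbit_eq h₁ hT').congr ⟨h, hh⟩
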